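/- **Signed Vizing's Theorem.** A signed simple graph $\Sigma=(\Gamma,\sigma)$ is a finite simple graph $\Gamma$ together with a signature $\sigma:E(\Gamma)\to\{+1,-1\}$; its maximum degree $\Delta(\Sigma)$ is the maximum degree of $\Gamma$. For $n\ge 0$ let $M_n=\{0,\pm1,\dots,\pm k\}$ if $n=2k+1$ and $M_n=\{\pm1,\dots,\pm k\}$ if $n=2k$. An $n$-edge coloring of $\Sigma$ assigns a color $\gamma(v,e)\in M_n$ to every incidence $(v,e)$ (an edge $e$ together with one of its endpoints $v$) such that $\gamma(v,e)=-\sigma(e)\,\gamma(w,e)$ for every edge $e$ with endpoints $v$ and $w$; it is proper if $\gamma(v,e)\ne\gamma(v,f)$ for any two distinct edges $e,f$ that share the vertex $v$. The chromatic index $\chi'(\Sigma)$ is the smallest $n$ for which $\Sigma$ has a proper $n$-edge coloring. Then every signed simple graph $\Sigma$ has a finite chromatic index, and $$\Delta(\Sigma)\le\chi'(\Sigma)\le\Delta(\Sigma)+1.$$ -/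

import Mathlib

/-- A signed simple graph: a simple graph with a sign `1` or `-1` on each of its edges. -/
structure SignedGraph (V : Type*) where
  /-- The underlying (unsigned) simple graph. -/
  graph : SimpleGraph V
  /-- The signature. -/
  sign : graph.edgeSet → ℤˣ

/-- The signed color set `M_n`: it is `{0, ±1, …, ±k}` if `n = 2k + 1` and `{±1, …, ±k}`
if `n = 2k`. -/
def signedColors (n : ℕ) : Set ℤ :=
  {c | |c| ≤ ((n / 2 : ℕ) : ℤ) ∧ (c = 0 → Odd n)}

namespace SignedGraph

variable {V : Type*}

/-- The incidences of a signed graph: pairs `(v, e)` where the vertex `v` is an endpoint of the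
edge `e`. -/
def Incidence (S : SignedGraph V) : Type _ :=
  {i : V × S.graph.edgeSet // i.1 ∈ (i.2 : Sym2 V)}

/-- An `n`-edge coloring: colors from `M_n` on all incidences such that
`γ(v, e) = -σ(e) γ(w, e)` for each edge `e` with endpoints `v` and `w`. -/
structure EdgeColoring (S : SignedGraph V) (n : ℕ) where
  /-- The color of an incidence. -/
  color : S.Incidence → ℤ
  color_mem : ∀ i, color i ∈ signedColors n
  color_eq : ∀ (e : S.graph.edgeSet) (v w : V) (hv : v ∈ (e : Sym2 V)) (hw : w ∈ (e : Sym2 V)),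
    v ≠ w → color ⟨(v, e), hv⟩ = -(S.sign e : ℤ) * color ⟨(w, e), hw⟩

/-- A coloring is proper if distinct incidences at the same vertex have distinct colors. -/
def EdgeColoring.IsProper {S : SignedGraph V} {n : ℕ} (γ : S.EdgeColoring n) : Prop :=
  ∀ (v : V) (e f : S.graph.edgeSet) (he : v ∈ (e : Sym2 V)) (hf : v ∈ (f : Sym2 V)),
    e ≠ f → γ.color ⟨(v, e), he⟩ ≠ γ.color ⟨(v, f), hf⟩

/-- The chromatic index: the smallest `n` such that there is a proper `n`-edge coloring
(and `⊤` if there is no such `n`). -/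
noncomputable def chromaticIndex (S : SignedGraph V) : ℕ∞ :=
  ⨅ n ∈ {n : ℕ | ∃ γ : S.EdgeColoring n, γ.IsProper}, (n : ℕ∞)

end SignedGraph

/-!
The lower bound holds because the colors at a vertex are distinct and there are at most `n` of them.

For the upper bound, a coloring with the `2k` nonzero colors `±1, …, ±k` is regarded as an ordinary
proper edge coloring of the signed double cover, on `V × {1, -1}`, which changes the signs of the
colors under the covering involution. The main point (`exists_isCoverColoring`) is that a signed
graph is colored with `2k` colors if its degrees are at most `2k` and its vertices of degree `2k`
are independent. If `Δ + 1 = 2k`, this applies directly. If `Δ = 2k`, give the color `0` to the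
edges of a maximal matching and apply it to the remaining graph: the vertices of degree `2k` are then
not covered by the matching, hence independent.

The vertices are added one at a time, those of degree `2k` last. So let `u` be a new vertex of
degree at most `2k` such that each of its neighbors misses at least two of the colors in the
present coloring. The edges at `u` can be colored as soon as one can choose distinct missing colors
at the neighbors; by Hall's theorem this is a matter of the family `m` of the sets of missing colors.
Treating one neighbor after another, one may assume that no set `X` of neighbors exceeds
`⋃ t ∈ X, m t` by more than one. If some `X` does exceed it, there are a least such set `S` and a
greatest one `B` (`exists_hasDeficiencyOne`). There is a color `α` missing at no vertex of `B`, and by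
counting there is a color `β` missing at three vertices of `S`. Exchange `α` and `β` along the Kempe
chain of one of these three vertices, `x`, and `-α` and `-β` along its image under the involution.
At `x` this replaces `β` by `α`, which alone would establish Hall's condition
(`HasDeficiencyOne.hall_replaceElem`). It may also change the missing colors at the other end `z` of
the chain, or of its image. If this makes a set `A` deficient that is not smaller than `B`, then `A`
is tight before this second change and `z` is the only vertex of `A` at which the color lost by `z`
is missing (`HasDeficiencyOne.exists_isObstruction`). Such a set does not exist when the color lost is
`α` or `β`. When it is `-α` or `-β`, two of the three choices of `x` lose the same color, and
submodularity of `X ↦ |{α} ∪ ⋃ t ∈ X, m t|` gives a contradiction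
(`HasDeficiencyOne.IsObstruction.false`). So one of the three exchanges decreases the size of the
greatest deficient set, and finitely many of them establish Hall's condition.
-/

/-! ### Set families of deficiency one -/

section Deficiency

set_option linter.unusedSectionVars false

variable {T C : Type*} [DecidableEq T] [DecidableEq C]

/-- The family `m` with `p` removed from and `q` added to its member `m x`. -/
def replaceElem (m : T → Finset C) (x : T) (p q : C) : T → Finset C :=
  Function.update m x (insert q ((m x).erase p))

lemma replaceElem_self (m : T → Finset C) (x : T) (p q : C) :
    replaceElem m x p q x = insert q ((m x).erase p) := by
  simp [replaceElem]

lemma replaceElem_of_ne (m : T → Finset C) {x y : T} (p q : C) (h : y ≠ x) :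
    replaceElem m x p q y = m y := by
  simp [replaceElem, h]

lemma mem_replaceElem_of_ne {m : T → Finset C} {x : T} {p q c : C} (hp : c ≠ p) (y : T)
    (h : c ∈ m y) : c ∈ replaceElem m x p q y := by
  by_cases hy : y = x
  · subst hy
    simp [replaceElem_self, hp, h]
  · rwa [replaceElem_of_ne m p q hy]

lemma mem_of_mem_replaceElem {m : T → Finset C} {x : T} {p q c : C} (hq : c ≠ q) (y : T)
    (h : c ∈ replaceElem m x p q y) : c ∈ m y := by
  by_cases hy : y = x
  · subst hy
    simp only [replaceElem_self, Finset.mem_insert, Finset.mem_erase] at h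
    tauto
  · rwa [replaceElem_of_ne m p q hy] at h

lemma card_union_add_card_add_card_le {P Q I E : Finset C} (hI : I ⊆ P ∩ Q) (hE : E ⊆ P ∩ Q)
    (hIE : Disjoint I E) : (P ∪ Q).card + (I.card + E.card) ≤ P.card + Q.card := by
  rw [← Finset.card_union_of_disjoint hIE, ← Finset.card_union_add_card_inter P Q]
  exact Nat.add_le_add_left (Finset.card_le_card (Finset.union_subset hI hE)) _

lemma biUnion_inter_subset (m : T → Finset C) (X Y : Finset T) :
    (X ∩ Y).biUnion m ⊆ X.biUnion m ∩ Y.biUnion m :=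
  Finset.subset_inter (Finset.biUnion_subset_biUnion_of_subset_left _ Finset.inter_subset_left)
    (Finset.biUnion_subset_biUnion_of_subset_left _ Finset.inter_subset_right)

lemma card_biUnion_union_add_inter_le (m : T → Finset C) (X Y : Finset T) :
    ((X ∪ Y).biUnion m).card + ((X ∩ Y).biUnion m).card
      ≤ (X.biUnion m).card + (Y.biUnion m).card := by
  have := card_union_add_card_add_card_le (biUnion_inter_subset m X Y)
    (Finset.empty_subset _) (Finset.disjoint_empty_right _)
  simpa [Finset.union_biUnion] using this

/-- The family `m` on the index set `N` violates Hall's condition by exactly one: every set of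
indices is too large for its union by at most one; `S` is the least and `B` the greatest of the
*deficient* sets, those larger than their union. -/
structure HasDeficiencyOne (m : T → Finset C) (N S B : Finset T) : Prop where
  card_le : ∀ X ⊆ N, X.card ≤ (X.biUnion m).card + 1
  subset_left : S ⊆ N
  deficient_left : (S.biUnion m).card < S.card
  subset_right : B ⊆ N
  deficient_right : (B.biUnion m).card < B.card
  least : ∀ X ⊆ N, (X.biUnion m).card < X.card → S ⊆ X
  greatest : ∀ X ⊆ N, (X.biUnion m).card < X.card → X ⊆ B

/-- Deficient sets of a family of deficiency one are closed under unions and intersections, so that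
a least and a greatest one exist. -/
lemma exists_hasDeficiencyOne {m : T → Finset C} {N : Finset T}
    (hN : ∀ X ⊆ N, X.card ≤ (X.biUnion m).card + 1)
    (h : ∃ X ⊆ N, (X.biUnion m).card < X.card) :
    ∃ S B, HasDeficiencyOne m N S B := by
  classical
  obtain ⟨X₀, hX₀, hX₀'⟩ := h
  let F := N.powerset.filter fun X => (X.biUnion m).card < X.card
  have hF : F.Nonempty := ⟨X₀, by simp [F, hX₀, hX₀']⟩
  have memF : ∀ X, X ∈ F ↔ X ⊆ N ∧ (X.biUnion m).card < X.card := by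
    intro X; simp [F]
  have key : ∀ X ∈ F, ∀ Y ∈ F, X ∩ Y ∈ F ∧ X ∪ Y ∈ F := by
    intro X hX Y hY
    rw [memF] at hX hY
    have hi : X ∩ Y ⊆ N := Finset.inter_subset_left.trans hX.1
    have hu : X ∪ Y ⊆ N := Finset.union_subset hX.1 hY.1
    have h1 := card_biUnion_union_add_inter_le m X Y
    have h2 := Finset.card_union_add_card_inter X Y
    have h3 := hN _ hi
    have h4 := hN _ hu
    rw [memF, memF]
    exact ⟨⟨hi, by omega⟩, ⟨hu, by omega⟩⟩
  obtain ⟨S, hS, hSmin⟩ := Finset.exists_min_image F Finset.card hF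
  obtain ⟨B, hB, hBmax⟩ := Finset.exists_max_image F Finset.card hF
  refine ⟨S, B, hN, ((memF S).1 hS).1, ((memF S).1 hS).2, ((memF B).1 hB).1, ((memF B).1 hB).2,
    fun X hX hX' => ?_, fun X hX hX' => ?_⟩
  · have hXF : X ∈ F := (memF X).2 ⟨hX, hX'⟩
    have := Finset.eq_of_subset_of_card_le Finset.inter_subset_left (hSmin _ (key S hS X hXF).1)
    exact Finset.inter_eq_left.1 this
  · have hXF : X ∈ F := (memF X).2 ⟨hX, hX'⟩
    have := Finset.eq_of_subset_of_card_le Finset.subset_union_left (hBmax _ (key B hB X hXF).2)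
    exact Finset.union_eq_left.1 this.symm

namespace HasDeficiencyOne

variable {m : T → Finset C} {N S B : Finset T} {α β p q : C} {x y z : T}

/-- If all members of the family have at least two elements, then, by counting, some element
lies in three members indexed by the least deficient set. -/
lemma exists_three (h : HasDeficiencyOne m N S B) (h2 : ∀ t ∈ N, 2 ≤ (m t).card) :
    ∃ β, ∃ x ∈ S, ∃ y ∈ S, ∃ z ∈ S, x ≠ y ∧ x ≠ z ∧ y ≠ z ∧ β ∈ m x ∧ β ∈ m y ∧ β ∈ m z := by
  by_contra! hcon
  have hle : ∀ c ∈ S.biUnion m, (S.filter fun t => c ∈ m t).card ≤ 2 := by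
    intro c _
    by_contra! hlt
    obtain ⟨a, b, d, ha, hb, hd, hab, had, hbd⟩ := Finset.two_lt_card_iff.1 hlt
    rw [Finset.mem_filter] at ha hb hd
    exact hcon c a ha.1 b hb.1 d hd.1 hab had hbd ha.2 hb.2 hd.2
  have hsum : ∑ t ∈ S, (m t).card = ∑ c ∈ S.biUnion m, (S.filter fun t => c ∈ m t).card := by
    refine Eq.trans ?_ (Finset.sum_card_bipartiteAbove_eq_sum_card_bipartiteBelow
      (r := fun t c => c ∈ m t) (s := S) (t := S.biUnion m))
    refine Finset.sum_congr rfl fun t ht => congrArg Finset.card ?_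
    ext c
    simp only [Finset.bipartiteAbove, Finset.mem_filter, Finset.mem_biUnion]
    exact ⟨fun hc => ⟨⟨t, ht, hc⟩, hc⟩, fun hc => hc.2⟩
  have h3 : S.card * 2 ≤ ∑ t ∈ S, (m t).card :=
    Finset.card_nsmul_le_sum S _ 2 fun t ht => h2 t (h.subset_left ht)
  have h4 := Finset.sum_le_card_nsmul _ _ 2 hle
  have := h.deficient_left
  rw [smul_eq_mul] at h4
  omega

/-- Adding to all unions an element `α` outside the largest deficient union repairs Hall's
condition, and only supersets of the least deficient set remain tight. -/
lemma card_le_insert (h : HasDeficiencyOne m N S B) (hα : α ∉ B.biUnion m) {X : Finset T}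
    (hX : X ⊆ N) : X.card ≤ (insert α (X.biUnion m)).card ∧
      (X.card = (insert α (X.biUnion m)).card → S ⊆ X) := by
  by_cases hd : (X.biUnion m).card < X.card
  · have hαX : α ∉ X.biUnion m := fun hmem =>
      hα (Finset.biUnion_subset_biUnion_of_subset_left _ (h.greatest X hX hd) hmem)
    have := h.card_le X hX
    rw [Finset.card_insert_of_notMem hαX]
    exact ⟨this, fun _ => h.least X hX hd⟩
  · push Not at hd
    by_cases hαX : α ∈ X.biUnion m
    · rw [Finset.insert_eq_of_mem hαX]
      refine ⟨hd, fun heq => ?_⟩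
      by_contra hS
      have hi : X ∩ B ⊆ N := Finset.inter_subset_left.trans hX
      have hu : X ∪ B ⊆ N := Finset.union_subset hX h.subset_right
      have h1 := card_biUnion_union_add_inter_le m X B
      have h2 := Finset.card_union_add_card_inter X B
      have h3 : ¬ ((X ∩ B).biUnion m).card < (X ∩ B).card := fun hlt =>
        hS ((h.least _ hi hlt).trans Finset.inter_subset_left)
      have h4 := h.deficient_right
      have h5 : X ∪ B ⊆ B := h.greatest _ hu (by omega)
      exact hα (Finset.biUnion_subset_biUnion_of_subset_left _
        (Finset.subset_union_left.trans h5) hαX)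
    · rw [Finset.card_insert_of_notMem hαX]
      exact ⟨by omega, fun heq => by omega⟩

lemma ne_of_mem (h : HasDeficiencyOne m N S B) (hα : α ∉ B.biUnion m) (hx : x ∈ S)
    (hβ : β ∈ m x) : β ≠ α := by
  rintro rfl
  exact hα (Finset.mem_biUnion.2 ⟨x, h.greatest S h.subset_left h.deficient_left hx, hβ⟩)

lemma biUnion_replaceElem_of_notMem {X : Finset T} (hx : x ∉ X) :
    X.biUnion (replaceElem m x p q) = X.biUnion m :=
  Finset.biUnion_congr rfl fun _ ht =>
    replaceElem_of_ne m p q (fun hh => hx (hh ▸ ht))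

lemma insert_biUnion_eq (hx : x ∈ N) (hβ : β ∈ m x) (hβα : β ≠ α) :
    insert β (N.biUnion (replaceElem m x β α)) = insert α (N.biUnion m) := by
  ext c
  simp only [Finset.mem_insert, Finset.mem_biUnion]
  by_cases hcα : c = α
  · subst hcα
    simp only [true_or, iff_true]
    exact Or.inr ⟨x, hx, by simp [replaceElem_self]⟩
  by_cases hcβ : c = β
  · subst hcβ
    simp only [true_or, true_iff]
    exact Or.inr ⟨x, hx, hβ⟩
  · simp only [hcα, hcβ, false_or]
    exact ⟨fun ⟨t, ht, hc⟩ => ⟨t, ht, mem_of_mem_replaceElem hcα t hc⟩,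
      fun ⟨t, ht, hc⟩ => ⟨t, ht, mem_replaceElem_of_ne hcβ t hc⟩⟩

/-- Replacing `β` by a free element `α` in one of two members indexed by `S` that contain `β`
restores Hall's condition. -/
lemma hall_replaceElem (h : HasDeficiencyOne m N S B) (hα : α ∉ B.biUnion m) (hx : x ∈ S)
    (hy : y ∈ S) (hxy : y ≠ x) (hβx : β ∈ m x) (hβy : β ∈ m y) {X : Finset T} (hX : X ⊆ N) :
    X.card ≤ (X.biUnion (replaceElem m x β α)).card := by
  have hβα := h.ne_of_mem hα hx hβx
  by_cases hxX : x ∈ X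
  · have heq := insert_biUnion_eq hxX hβx hβα
    obtain ⟨h1, h2⟩ := h.card_le_insert hα hX
    rw [← heq] at h1 h2
    by_cases hb : β ∈ X.biUnion (replaceElem m x β α)
    · rwa [Finset.insert_eq_of_mem hb] at h1
    · have hne : X.card ≠ (insert β (X.biUnion (replaceElem m x β α))).card := fun hc =>
        hb (Finset.mem_biUnion.2 ⟨y, h2 hc hy, by rwa [replaceElem_of_ne m β α hxy]⟩)
      rw [Finset.card_insert_of_notMem hb] at h1 hne
      omega
  · rw [biUnion_replaceElem_of_notMem hxX]
    by_contra! hlt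
    exact hxX (h.least X hX hlt hx)

lemma erase_biUnion_subset_replaceElem (X : Finset T) :
    (X.biUnion m).erase p ⊆ X.biUnion (replaceElem m z p q) := by
  intro c hc
  rw [Finset.mem_erase, Finset.mem_biUnion] at hc
  obtain ⟨hcp, t, ht, hct⟩ := hc
  exact Finset.mem_biUnion.2 ⟨t, ht, mem_replaceElem_of_ne hcp t hct⟩

/-- A second replacement can only spoil Hall's condition by one. -/
lemma card_le_replaceElem_replaceElem (h : HasDeficiencyOne m N S B) (hα : α ∉ B.biUnion m)
    (hx : x ∈ S) (hy : y ∈ S) (hxy : y ≠ x) (hβx : β ∈ m x) (hβy : β ∈ m y) {X : Finset T}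
    (hX : X ⊆ N) :
    X.card ≤ (X.biUnion (replaceElem (replaceElem m x β α) z p q)).card + 1 := by
  have h1 := h.hall_replaceElem hα hx hy hxy hβx hβy hX
  have h2 := Finset.card_le_card
    (erase_biUnion_subset_replaceElem (m := replaceElem m x β α) (p := p) (q := q) (z := z) X)
  have h3 := Finset.pred_card_le_card_erase (s := X.biUnion (replaceElem m x β α)) (a := p)
  omega

/-- The set of indices `A` is tight after the replacement of `β` by `α` at `x`; it contains `x` and
`z`, and `z` is the only one of its indices at which `p` occurs after this replacement. If now `p`
is lost at `z`, then `A` may become deficient. -/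
structure IsObstruction (m : T → Finset C) (N : Finset T) (x : T) (β α : C) (z : T) (p : C)
    (A : Finset T) : Prop where
  subset : A ⊆ N
  mem_left : x ∈ A
  mem_right : z ∈ A
  tight : (A.biUnion (replaceElem m x β α)).card = A.card
  mem : p ∈ replaceElem m x β α z
  notMem : ∀ w ∈ A, w ≠ z → p ∉ replaceElem m x β α w

/-- If two successive replacements do not decrease the size of the greatest deficient set, then
there is an obstruction. -/
lemma exists_isObstruction (h : HasDeficiencyOne m N S B) (hα : α ∉ B.biUnion m)
    (hx : x ∈ S) (hy : y ∈ S) (hxy : y ≠ x) (hβx : β ∈ m x) (hβy : β ∈ m y) {A : Finset T}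
    (hA : A ⊆ N)
    (hdef : (A.biUnion (replaceElem (replaceElem m x β α) z p q)).card < A.card)
    (hBA : B.card ≤ A.card) : IsObstruction m N x β α z p A := by
  have h1 := h.hall_replaceElem hα hx hy hxy hβx hβy hA
  have hsub := erase_biUnion_subset_replaceElem
    (m := replaceElem m x β α) (p := p) (q := q) (z := z) A
  have h2 := Finset.card_le_card hsub
  have h3 := Finset.pred_card_le_card_erase (s := A.biUnion (replaceElem m x β α)) (a := p)
  have htight : (A.biUnion (replaceElem m x β α)).card = A.card := by omega
  have hp : p ∉ A.biUnion (replaceElem (replaceElem m x β α) z p q) := by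
    intro hp
    have : A.biUnion (replaceElem m x β α) ⊆
        A.biUnion (replaceElem (replaceElem m x β α) z p q) := by
      intro c hc
      by_cases hcp : c = p
      · rwa [hcp]
      · exact hsub (Finset.mem_erase.2 ⟨hcp, hc⟩)
    have := Finset.card_le_card this
    omega
  have hp1 : p ∈ A.biUnion (replaceElem m x β α) := by
    by_contra hp1
    rw [Finset.erase_eq_of_notMem hp1] at h2
    omega
  have hnot : ∀ w ∈ A, w ≠ z → p ∉ replaceElem m x β α w := by
    intro w hw hwz hpw
    exact hp (Finset.mem_biUnion.2 ⟨w, hw, by rwa [replaceElem_of_ne _ p q hwz]⟩)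
  obtain ⟨t, ht, hpt⟩ := Finset.mem_biUnion.1 hp1
  have htz : t = z := by
    by_contra hne
    exact hnot t ht hne hpt
  subst htz
  refine ⟨hA, ?_, ht, htight, hpt, hnot⟩
  -- Otherwise `A` is tight for `m`, and then `A ∪ B` is deficient, so that `A ⊆ B \ {x}`.
  by_contra hxA
  rw [biUnion_replaceElem_of_notMem hxA] at htight
  have hi : A ∩ B ⊆ N := Finset.inter_subset_left.trans hA
  have hu : A ∪ B ⊆ N := Finset.union_subset hA h.subset_right
  have h4 := card_biUnion_union_add_inter_le m A B
  have h5 := Finset.card_union_add_card_inter A B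
  have h6 : ¬ ((A ∩ B).biUnion m).card < (A ∩ B).card := fun hlt =>
    hxA (Finset.inter_subset_left (h.least _ hi hlt hx))
  have h7 := h.deficient_right
  have h8 : A ∪ B ⊆ B := h.greatest _ hu (by omega)
  have h9 : A = B := Finset.eq_of_subset_of_card_le (Finset.subset_union_left.trans h8) hBA
  exact hxA (h9 ▸ h.greatest S h.subset_left h.deficient_left hx)

/-- An obstruction either contains the least deficient set, or has `x` as the only one of its
indices at which `β` occurs. -/
lemma IsObstruction.subset_or (h : HasDeficiencyOne m N S B) (hα : α ∉ B.biUnion m)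
    (hx : x ∈ S) (hβx : β ∈ m x) {A : Finset T} (hA : IsObstruction m N x β α z p A) :
    (insert α (A.biUnion m)).card = A.card ∧ S ⊆ A ∨
      (insert α (A.biUnion m)).card = A.card + 1 ∧ ∀ w ∈ A, w ≠ x → β ∉ m w := by
  have hβα := h.ne_of_mem hα hx hβx
  have heq := insert_biUnion_eq hA.mem_left hβx hβα
  by_cases hb : β ∈ A.biUnion (replaceElem m x β α)
  · rw [Finset.insert_eq_of_mem hb] at heq
    have : (insert α (A.biUnion m)).card = A.card := by rw [← heq, hA.tight]
    exact Or.inl ⟨this, (h.card_le_insert hα hA.subset).2 this.symm⟩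
  · refine Or.inr ⟨by rw [← heq, Finset.card_insert_of_notMem hb, hA.tight], ?_⟩
    intro w hw hwx hβw
    exact hb (Finset.mem_biUnion.2 ⟨w, hw, by rwa [replaceElem_of_ne m β α hwx]⟩)

lemma IsObstruction.ne_left {A : Finset T} (hA : IsObstruction m N x β α z p A) (hzx : z ≠ x) :
    p ≠ α := by
  rintro rfl
  exact hA.notMem x hA.mem_left hzx.symm (by simp [replaceElem_self])

lemma IsObstruction.ne_right (h : HasDeficiencyOne m N S B) (hα : α ∉ B.biUnion m)
    {x₂ x₃ : T} (hx : x ∈ S) (hx₂ : x₂ ∈ S) (hx₃ : x₃ ∈ S) (h₂ : x₂ ≠ x) (h₃ : x₃ ≠ x)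
    (h₂₃ : x₂ ≠ x₃) (hβ : β ∈ m x) (hβ₂ : β ∈ m x₂) (hβ₃ : β ∈ m x₃) {A : Finset T}
    (hA : IsObstruction m N x β α z p A) (hzx : z ≠ x) : p ≠ β := by
  rintro rfl
  have hpz : p ∈ m z := by
    have := hA.mem
    rwa [replaceElem_of_ne m p α hzx] at this
  rcases IsObstruction.subset_or h hα hx hβ hA with ⟨-, hS⟩ | ⟨-, hno⟩
  · by_cases hz : x₂ = z
    · exact hA.notMem x₃ (hS hx₃) (fun hh => h₂₃ (hz.trans hh.symm))
        (by rwa [replaceElem_of_ne m p α h₃])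
    · exact hA.notMem x₂ (hS hx₂) hz (by rwa [replaceElem_of_ne m p α h₂])
  · exact hno z hA.mem_right hzx hpz

/-- Obstructions for two different indices `x₁`, `x₂` of the least deficient set, with the same
element `p` but at different `z₁`, `z₂`, contradict the submodularity of
`X ↦ |{α} ∪ ⋃ t ∈ X, m t|`. -/
lemma IsObstruction.false (h : HasDeficiencyOne m N S B) (hα : α ∉ B.biUnion m)
    {x₁ x₂ z₁ z₂ : T} (hx₁ : x₁ ∈ S) (hx₂ : x₂ ∈ S) (h₁₂ : x₁ ≠ x₂) (hβ₁ : β ∈ m x₁)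
    (hβ₂ : β ∈ m x₂) (hz : z₁ ≠ z₂) (hpα : p ≠ α) (hpβ : p ≠ β) {A₁ A₂ : Finset T}
    (hA₁ : IsObstruction m N x₁ β α z₁ p A₁) (hA₂ : IsObstruction m N x₂ β α z₂ p A₂) :
    False := by
  have hβα := h.ne_of_mem hα hx₁ hβ₁
  have hp₁ : p ∈ m z₁ := mem_of_mem_replaceElem hpα _ hA₁.mem
  have hp₂ : p ∈ m z₂ := mem_of_mem_replaceElem hpα _ hA₂.mem
  have hpA₁ : ∀ w ∈ A₁, p ∈ m w → w = z₁ := fun w hw hpw => by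
    by_contra hne
    exact hA₁.notMem w hw hne (mem_replaceElem_of_ne hpβ w hpw)
  have hpA₂ : ∀ w ∈ A₂, p ∈ m w → w = z₂ := fun w hw hpw => by
    by_contra hne
    exact hA₂.notMem w hw hne (mem_replaceElem_of_ne hpβ w hpw)
  have hi : A₁ ∩ A₂ ⊆ N := Finset.inter_subset_left.trans hA₁.subset
  have hu : A₁ ∪ A₂ ⊆ N := Finset.union_subset hA₁.subset hA₂.subset
  have hI : insert α ((A₁ ∩ A₂).biUnion m)
      ⊆ insert α (A₁.biUnion m) ∩ insert α (A₂.biUnion m) := by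
    rw [← Finset.insert_inter_distrib]
    exact Finset.insert_subset_insert _ (biUnion_inter_subset m A₁ A₂)
  have hU : insert α (A₁.biUnion m) ∪ insert α (A₂.biUnion m)
      = insert α ((A₁ ∪ A₂).biUnion m) := by
    rw [← Finset.insert_union_distrib, Finset.union_biUnion]
  have hpI : p ∉ insert α ((A₁ ∩ A₂).biUnion m) := by
    simp only [Finset.mem_insert, Finset.mem_biUnion, Finset.mem_inter, not_or, not_exists]
    refine ⟨hpα, fun t ht => hz ?_⟩
    rw [← hpA₁ t ht.1.1 ht.2, ← hpA₂ t ht.1.2 ht.2]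
  have hpE : p ∈ insert α (A₁.biUnion m) ∩ insert α (A₂.biUnion m) := by
    simp only [Finset.mem_inter, Finset.mem_insert, Finset.mem_biUnion]
    exact ⟨Or.inr ⟨z₁, hA₁.mem_right, hp₁⟩, Or.inr ⟨z₂, hA₂.mem_right, hp₂⟩⟩
  have hsub₁ := card_union_add_card_add_card_le hI (Finset.singleton_subset_iff.2 hpE)
    (Finset.disjoint_singleton_right.2 hpI)
  rw [hU, Finset.card_singleton] at hsub₁
  obtain ⟨hi1, hi2⟩ := h.card_le_insert hα hi
  obtain ⟨hu1, -⟩ := h.card_le_insert hα hu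
  have hcard := Finset.card_union_add_card_inter A₁ A₂
  have hx₂A₁ : S ⊆ A₁ ∩ A₂ → x₂ ∈ A₁ := fun hS => Finset.inter_subset_left (hS hx₂)
  have hx₁A₂ : S ⊆ A₁ ∩ A₂ → x₁ ∈ A₂ := fun hS => Finset.inter_subset_right (hS hx₁)
  rcases IsObstruction.subset_or h hα hx₁ hβ₁ hA₁ with ⟨e₁, -⟩ | ⟨e₁, n₁⟩ <;>
    rcases IsObstruction.subset_or h hα hx₂ hβ₂ hA₂ with ⟨e₂, -⟩ | ⟨e₂, n₂⟩
  · omega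
  · exact n₂ x₁ (hx₁A₂ (hi2 (by omega))) h₁₂ hβ₁
  · exact n₁ x₂ (hx₂A₁ (hi2 (by omega))) h₁₂.symm hβ₂
  · -- Here `β` is counted twice as well.
    have hβI : β ∉ insert α ((A₁ ∩ A₂).biUnion m) := by
      simp only [Finset.mem_insert, Finset.mem_biUnion, Finset.mem_inter, not_or, not_exists]
      refine ⟨hβα, fun t ht => h₁₂ ?_⟩
      have t₁ : t = x₁ := by
        by_contra hne
        exact n₁ t ht.1.1 hne ht.2
      have t₂ : t = x₂ := by
        by_contra hne
        exact n₂ t ht.1.2 hne ht.2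
      rw [← t₁, t₂]
    have hβE : β ∈ insert α (A₁.biUnion m) ∩ insert α (A₂.biUnion m) := by
      simp only [Finset.mem_inter, Finset.mem_insert, Finset.mem_biUnion]
      exact ⟨Or.inr ⟨x₁, hA₁.mem_left, hβ₁⟩, Or.inr ⟨x₂, hA₂.mem_left, hβ₂⟩⟩
    have hsub₂ := card_union_add_card_add_card_le (E := {p, β}) hI
      (Finset.insert_subset hpE (Finset.singleton_subset_iff.2 hβE))
      (by simp only [Finset.disjoint_insert_right, Finset.disjoint_singleton_right]
          exact ⟨hpI, hβI⟩)
    rw [hU, Finset.card_pair hpβ] at hsub₂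
    exact n₁ x₂ (hx₂A₁ (hi2 (by omega))) h₁₂.symm hβ₂

end HasDeficiencyOne

end Deficiency

/-! ### Kempe chains in equivariant colorings -/

/-- A connected graph with all degrees at most two has at most two vertices of degree at most
one, since the degrees sum up to at least `2 (n - 1)`. -/
lemma SimpleGraph.false_of_three_ends {W : Type*} [Finite W] (G : SimpleGraph W)
    (h2 : ∀ w, (G.neighborSet w).ncard ≤ 2) {a b c : W} (hab : a ≠ b) (hac : a ≠ c) (hbc : b ≠ c)
    (hb : G.Reachable a b) (hc : G.Reachable a c) (ha1 : (G.neighborSet a).ncard ≤ 1)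
    (hb1 : (G.neighborSet b).ncard ≤ 1) (hc1 : (G.neighborSet c).ncard ≤ 1) : False := by
  classical
  have := Fintype.ofFinite W
  let K := G.connectedComponentMk a
  have hdeg : ∀ v : K, K.toSimpleGraph.degree v ≤ (G.neighborSet v).ncard := by
    intro v
    rw [← SimpleGraph.card_neighborSet_eq_degree, ← Nat.card_eq_fintype_card,
      ← Nat.card_coe_set_eq]
    exact Nat.card_le_card_of_injective
      (fun w : K.toSimpleGraph.neighborSet v => (⟨w.1.1, w.2⟩ : G.neighborSet v.1))
      (fun x y hxy => Subtype.ext (Subtype.ext (congrArg (fun z => z.1) hxy)))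
  have hconn : K.toSimpleGraph.Connected := K.connected_toSimpleGraph
  have hE := hconn.card_vert_le_card_edgeSet_add_one
  have hsum := K.toSimpleGraph.sum_degrees_eq_twice_card_edges
  let a' : K := ⟨a, rfl⟩
  let b' : K := ⟨b, SimpleGraph.ConnectedComponent.sound hb.symm⟩
  let c' : K := ⟨c, SimpleGraph.ConnectedComponent.sound hc.symm⟩
  let E : Finset K := {a', b', c'}
  have hEcard : E.card = 3 := by
    apply Finset.card_eq_three.2
    exact ⟨a', b', c', fun h => hab (congrArg Subtype.val h), fun h => hac (congrArg Subtype.val h),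
      fun h => hbc (congrArg Subtype.val h), rfl⟩
  have h3 : ∑ v : K, (K.toSimpleGraph.degree v + if v ∈ E then 1 else 0) ≤ ∑ _v : K, 2 := by
    refine Finset.sum_le_sum fun v _ => ?_
    have h1 := hdeg v
    have h2v := h2 v
    split_ifs with hv
    · have : (G.neighborSet v.1).ncard ≤ 1 := by
        simp only [E, Finset.mem_insert, Finset.mem_singleton] at hv
        rcases hv with rfl | rfl | rfl
        · exact ha1
        · exact hb1
        · exact hc1
      omega
    · omega
  rw [Finset.sum_add_distrib, hsum, Finset.sum_ite_mem, Finset.univ_inter, Finset.sum_const,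
    hEcard, Finset.sum_const, Finset.card_univ] at h3
  rw [Nat.card_eq_fintype_card, Nat.card_eq_fintype_card, ← SimpleGraph.edgeFinset_card] at hE
  simp only [smul_eq_mul] at h3
  omega

/-- A proper edge coloring with nonzero colors of absolute value at most `k` of a graph on `W`
with an involution `ι` that reverses the signs of the colors. It is encoded as a function on pairs
of vertices, with the value `0` on the pairs that are not edges. For the signed double cover of a
signed graph these are the proper `2k`-edge colorings of the signed graph. -/
structure IsEquivariantColoring {W : Type*} (ι : W → W) (k : ℕ) (f : W → W → ℤ) : Prop where
  symm : ∀ x y, f x y = f y x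
  loopless : ∀ x, f x x = 0
  neg : ∀ x y, f (ι x) (ι y) = -f x y
  proper : ∀ x y z, f x y = f x z → f x y ≠ 0 → y = z
  abs_le : ∀ x y, |f x y| ≤ k

/-- The nonzero integers of absolute value at most `k`. -/
noncomputable def palette (k : ℕ) : Finset ℤ := (Finset.Icc (-k : ℤ) k).erase 0

lemma mem_palette {k : ℕ} {c : ℤ} : c ∈ palette k ↔ c ≠ 0 ∧ |c| ≤ k := by
  simp [palette, abs_le]

lemma neg_mem_palette {k : ℕ} {c : ℤ} : -c ∈ palette k ↔ c ∈ palette k := by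
  simp [mem_palette]

lemma card_palette (k : ℕ) : (palette k).card = 2 * k := by
  rw [palette, Finset.card_erase_of_mem (by simp), Int.card_Icc]
  omega

section Kempe

set_option linter.unusedSectionVars false

variable {W : Type*} [Fintype W]

/-- The colors of the palette that do not occur at the vertex `x`. -/
noncomputable def missingColors (k : ℕ) (f : W → W → ℤ) (x : W) : Finset ℤ :=
  (palette k).filter fun c => ∀ y, f x y ≠ c

lemma mem_missingColors {k : ℕ} {f : W → W → ℤ} {x : W} {c : ℤ} :
    c ∈ missingColors k f x ↔ c ∈ palette k ∧ ∀ y, f x y ≠ c := by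
  simp [missingColors]

/-- The subgraph of the edges of colors `α` and `β`. -/
def kempeGraph (f : W → W → ℤ) (α β : ℤ) : SimpleGraph W :=
  SimpleGraph.fromRel fun x y => f x y = α ∨ f x y = β

namespace IsEquivariantColoring

variable {ι : W → W} {k : ℕ} {f : W → W → ℤ} {α β : ℤ}

lemma kempeGraph_adj (h : IsEquivariantColoring ι k f) (hα : α ≠ 0) (hβ : β ≠ 0) {x y : W} :
    (kempeGraph f α β).Adj x y ↔ f x y = α ∨ f x y = β := by
  rw [kempeGraph, SimpleGraph.fromRel_adj, h.symm y x, or_self]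
  refine ⟨fun hh => hh.2, fun hh => ⟨?_, hh⟩⟩
  rintro rfl
  rw [h.loopless] at hh
  rcases hh with hh | hh
  · exact hα hh.symm
  · exact hβ hh.symm

lemma ncard_neighborSet_le (h : IsEquivariantColoring ι k f) (hα : α ≠ 0) (hβ : β ≠ 0) (s : Set ℤ)
    (hs : s.Finite) (x : W) (hx : ∀ y, f x y = α ∨ f x y = β → f x y ∈ s) :
    ((kempeGraph f α β).neighborSet x).ncard ≤ s.ncard := by
  refine Set.ncard_le_ncard_of_injOn (f x) (fun y hy => ?_) (fun y hy z hz hyz => ?_) hs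
  · exact hx y ((h.kempeGraph_adj hα hβ).1 hy)
  · refine h.proper x y z hyz ?_
    rcases (h.kempeGraph_adj hα hβ).1 hy with hh | hh <;> rw [hh] <;> assumption

/-- At most two vertices of a Kempe chain miss one of its colors. -/
lemma false_of_three_missing (h : IsEquivariantColoring ι k f) (hα : α ≠ 0) (hβ : β ≠ 0)
    {a b c : W} (hab : a ≠ b) (hac : a ≠ c) (hbc : b ≠ c)
    (hb : (kempeGraph f α β).Reachable a b) (hc : (kempeGraph f α β).Reachable a c)
    (ha1 : α ∈ missingColors k f a ∨ β ∈ missingColors k f a)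
    (hb1 : α ∈ missingColors k f b ∨ β ∈ missingColors k f b)
    (hc1 : α ∈ missingColors k f c ∨ β ∈ missingColors k f c) : False := by
  have key : ∀ x, α ∈ missingColors k f x ∨ β ∈ missingColors k f x →
      ((kempeGraph f α β).neighborSet x).ncard ≤ 1 := by
    rintro x (hx | hx)
    · rw [← Set.ncard_singleton β]
      refine h.ncard_neighborSet_le hα hβ _ (Set.finite_singleton _) x fun y hy => ?_
      exact hy.resolve_left ((mem_missingColors.1 hx).2 y)
    · rw [← Set.ncard_singleton α]
      refine h.ncard_neighborSet_le hα hβ _ (Set.finite_singleton _) x fun y hy => ?_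
      exact hy.resolve_right ((mem_missingColors.1 hx).2 y)
  refine (kempeGraph f α β).false_of_three_ends (fun w => ?_) hab hac hbc hb hc (key a ha1)
    (key b hb1) (key c hc1)
  refine (h.ncard_neighborSet_le hα hβ {α, β} (by simp) w fun y hy => ?_).trans
    ((Set.ncard_insert_le α {β}).trans (by simp))
  simpa using hy

lemma missingColors_involution (h : IsEquivariantColoring ι k f) (hι : Function.Involutive ι)
    (x : W) (c : ℤ) : c ∈ missingColors k f (ι x) ↔ -c ∈ missingColors k f x := by
  rw [mem_missingColors, mem_missingColors, neg_mem_palette]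
  refine and_congr_right fun _ => ⟨fun hh y hy => hh (ι y) ?_, fun hh y hy => hh (ι y) ?_⟩
  · rw [h.neg, hy, neg_neg]
  · have := h.neg x (ι y)
    rw [hι y] at this
    rw [← hy, this, neg_neg]

/-- Colors may be permuted at each vertex separately, if the two ends of each edge agree. -/
lemma recolor (h : IsEquivariantColoring ι k f) (π : W → Equiv.Perm ℤ) (h0 : ∀ x, π x 0 = 0)
    (habs : ∀ x c, |π x c| ≤ k ↔ |c| ≤ k) (hneg : ∀ x c, π (ι x) (-c) = -π x c)
    (hcomp : ∀ x y, π x (f x y) = π y (f x y)) :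
    IsEquivariantColoring ι k (fun x y => π x (f x y)) ∧
      (∀ x y, π x (f x y) = 0 ↔ f x y = 0) ∧
      ∀ x, missingColors k (fun x y => π x (f x y)) x = (missingColors k f x).image (π x) := by
  have hz : ∀ x c, π x c = 0 ↔ c = 0 := fun x c =>
    ⟨fun hh => (π x).injective (hh.trans (h0 x).symm), fun hh => by rw [hh, h0]⟩
  refine ⟨⟨fun x y => ?_, fun x => ?_, fun x y => ?_, fun x y z hyz hne => ?_, fun x y => ?_⟩,
    fun x y => hz x _, fun x => ?_⟩
  · rw [hcomp, h.symm]
  · rw [h.loopless, h0]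
  · rw [h.neg, hneg]
  · exact h.proper x y z ((π x).injective hyz) (fun hh => hne ((hz x _).2 hh))
  · exact (habs x _).2 (h.abs_le x y)
  · ext c
    simp only [mem_missingColors, Finset.mem_image, mem_palette]
    constructor
    · rintro ⟨⟨hc0, hck⟩, hc⟩
      refine ⟨(π x).symm c, ⟨⟨fun hh => hc0 ?_, ?_⟩, fun y hy => hc y ?_⟩, by simp⟩
      · rw [Equiv.symm_apply_eq, h0] at hh
        exact hh
      · rw [← habs x, Equiv.apply_symm_apply]
        exact hck
      · rw [hy, Equiv.apply_symm_apply]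
    · rintro ⟨d, ⟨⟨hd0, hdk⟩, hd⟩, rfl⟩
      exact ⟨⟨fun hh => hd0 ((hz x d).1 hh), (habs x d).2 hdk⟩,
        fun y hy => hd y ((π x).injective hy)⟩

end IsEquivariantColoring

lemma Finset.image_swap_of_mem {s : Finset ℤ} {p q : ℤ} (hp : p ∈ s) (hq : q ∉ s) :
    s.image (Equiv.swap p q) = insert q (s.erase p) := by
  ext c
  simp only [Finset.mem_image, Finset.mem_insert, Finset.mem_erase]
  constructor
  · rintro ⟨d, hd, rfl⟩
    by_cases h1 : d = p
    · subst h1; simp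
    · have h2 : d ≠ q := fun hh => hq (hh ▸ hd)
      rw [Equiv.swap_apply_of_ne_of_ne h1 h2]
      exact Or.inr ⟨h1, hd⟩
  · rintro (rfl | ⟨h1, h2⟩)
    · exact ⟨p, hp, by simp⟩
    · exact ⟨c, h2, Equiv.swap_apply_of_ne_of_ne h1 fun hh => hq (hh ▸ h2)⟩

lemma Finset.image_swap_of_iff {s : Finset ℤ} {p q : ℤ} (h : p ∈ s ↔ q ∈ s) :
    s.image (Equiv.swap p q) = s := by
  have key : ∀ c ∈ s, Equiv.swap p q c ∈ s := by
    intro c hc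
    by_cases h1 : c = p
    · subst h1; simpa using h.1 hc
    · by_cases h2 : c = q
      · subst h2; simpa using h.2 hc
      · rwa [Equiv.swap_apply_of_ne_of_ne h1 h2]
  refine Finset.Subset.antisymm (fun c hc => ?_) fun c hc => ?_
  · obtain ⟨d, hd, rfl⟩ := Finset.mem_image.1 hc
    exact key d hd
  · exact Finset.mem_image.2 ⟨_, key c hc, by simp⟩

end Kempe

section KempeSwap

variable {W : Type*} [Fintype W]

namespace IsEquivariantColoring

variable {ι : W → W} {k : ℕ} {f : W → W → ℤ} {α β : ℤ}

/-- A vertex `w`, other than `x`, that is an end of the `α`-`β` chain of `x`. -/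
def IsOtherEnd (k : ℕ) (f : W → W → ℤ) (α β : ℤ) (x w : W) : Prop :=
  w ≠ x ∧ (kempeGraph f α β).Reachable x w ∧
    (α ∈ missingColors k f w ∨ β ∈ missingColors k f w)

lemma IsOtherEnd.unique (h : IsEquivariantColoring ι k f) (hα : α ≠ 0) (hβ : β ≠ 0) {x v w : W}
    (hx : β ∈ missingColors k f x) (hv : IsOtherEnd k f α β x v) (hw : IsOtherEnd k f α β x w) :
    v = w := by
  by_contra hne
  exact h.false_of_three_missing hα hβ hv.1.symm hw.1.symm hne hv.2.1 hw.2.1 (Or.inr hx)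
    hv.2.2 hw.2.2

open Classical in
/-- Exchange of `α` and `β` along the chain of `x` and of `-α` and `-β` along its image under the
involution, for `β ≠ -α`. -/
lemma exists_swap (h : IsEquivariantColoring ι k f) (hι : Function.Involutive ι)
    (hα : α ∈ palette k) (hβ : β ∈ palette k) (hβα : β ≠ -α) (x : W) :
    ∃ f', IsEquivariantColoring ι k f' ∧ (∀ v w, f' v w = 0 ↔ f v w = 0) ∧
      ∀ w, missingColors k f' w =
        ((missingColors k f w).image
          ⇑(if (kempeGraph f α β).Reachable x w then Equiv.swap α β else 1 : Equiv.Perm ℤ)).image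
          ⇑(if (kempeGraph f α β).Reachable x (ι w) then Equiv.swap (-α) (-β) else 1 :
            Equiv.Perm ℤ) := by
  rw [mem_palette] at hα hβ
  obtain ⟨hα0, hαk⟩ := hα
  obtain ⟨hβ0, hβk⟩ := hβ
  let R : W → Prop := (kempeGraph f α β).Reachable x
  let σ : W → Equiv.Perm ℤ := fun w => if R w then Equiv.swap α β else 1
  let τ : W → Equiv.Perm ℤ := fun w => if R (ι w) then Equiv.swap (-α) (-β) else 1
  have hR : ∀ v w, f v w = α ∨ f v w = β → (R v ↔ R w) := fun v w hvw =>
    have hadj := ((h.kempeGraph_adj hα0 hβ0).2 hvw).reachable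
    ⟨fun hh => hh.trans hadj, fun hh => hh.trans hadj.symm⟩
  have hne : ∀ c, c ≠ α → c ≠ β → ∀ w, σ w c = c := by
    intro c h1 h2 w
    simp only [σ]
    split_ifs
    · exact Equiv.swap_apply_of_ne_of_ne h1 h2
    · rfl
  have hne' : ∀ c, -c ≠ α → -c ≠ β → ∀ w, τ w c = c := by
    intro c h1 h2 w
    simp only [τ]
    split_ifs
    · exact Equiv.swap_apply_of_ne_of_ne (by omega) (by omega)
    · rfl
  have hσα : ∀ w, σ w α = α ∨ σ w α = β := by
    intro w; simp only [σ]; split_ifs <;> simp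
  have hσβ : ∀ w, σ w β = α ∨ σ w β = β := by
    intro w; simp only [σ]; split_ifs <;> simp
  -- On `±α` and `±β` at most one of the two factors acts.
  have hτσ : ∀ w c, (c = α ∨ c = β) → τ w (σ w c) = σ w c := by
    rintro w c (rfl | rfl)
    · rcases hσα w with hh | hh <;> rw [hh] <;> exact hne' _ (by omega) (by omega) w
    · rcases hσβ w with hh | hh <;> rw [hh] <;> exact hne' _ (by omega) (by omega) w
  have hστ : ∀ w c, ¬ (c = α ∨ c = β) → τ w (σ w c) = τ w c := by
    intro w c hc
    push Not at hc
    rw [hne c hc.1 hc.2]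
  have hswap : ∀ w c, τ w (-c) = -σ (ι w) c := by
    intro w c
    simp only [σ, τ]
    split_ifs
    · simp only [Equiv.swap_apply_def]
      split_ifs <;> omega
    · rfl
  have hswap' : ∀ w c, τ (ι w) (-c) = -σ w c := fun w c => by rw [hswap, hι]
  have hσk : ∀ w c, |σ w c| ≤ k ↔ |c| ≤ k := by
    intro w c
    by_cases h1 : c = α
    · subst h1
      rcases hσα w with hh | hh <;> simp [hh, hαk, hβk]
    · by_cases h2 : c = β
      · subst h2
        rcases hσβ w with hh | hh <;> simp [hh, hαk, hβk]
      · rw [hne c h1 h2]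
  have hτk : ∀ w c, |τ w c| ≤ k ↔ |c| ≤ k := by
    intro w c
    have := hswap w (-c)
    rw [neg_neg] at this
    rw [this, abs_neg, hσk, abs_neg]
  have e0 : ∀ w, (τ w * σ w) 0 = 0 := by
    intro w
    rw [Equiv.Perm.mul_apply, hne 0 hα0.symm hβ0.symm, hne' 0 (by simpa using hα0.symm)
      (by simpa using hβ0.symm)]
  have ek : ∀ w c, |(τ w * σ w) c| ≤ k ↔ |c| ≤ k := by
    intro w c
    rw [Equiv.Perm.mul_apply, hτk, hσk]
  have eneg : ∀ w c, (τ (ι w) * σ (ι w)) (-c) = -(τ w * σ w) c := by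
    intro w c
    rw [Equiv.Perm.mul_apply, Equiv.Perm.mul_apply]
    by_cases hc : c = α ∨ c = β
    · rw [hτσ w c hc, hστ (ι w) (-c) (by omega), hswap']
    · rw [hστ w c hc]
      by_cases hc' : -c = α ∨ -c = β
      · rw [hτσ (ι w) (-c) hc']
        have := hswap w (-c)
        rw [neg_neg] at this
        rw [this, neg_neg]
      · rw [hστ (ι w) (-c) hc', hswap', hne c (by omega) (by omega),
          hne' c (by omega) (by omega)]
  have ecomp : ∀ v w, (τ v * σ v) (f v w) = (τ w * σ w) (f v w) := by
    intro v w
    rw [Equiv.Perm.mul_apply, Equiv.Perm.mul_apply]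
    by_cases hc : f v w = α ∨ f v w = β
    · rw [hτσ v _ hc, hτσ w _ hc]
      simp only [σ, hR v w hc]
    · rw [hστ v _ hc, hστ w _ hc]
      by_cases hc' : -f v w = α ∨ -f v w = β
      · rw [← h.neg] at hc'
        simp only [τ, hR _ _ hc']
      · rw [hne' _ (by omega) (by omega), hne' _ (by omega) (by omega)]
  obtain ⟨h1, h2, h3⟩ := h.recolor (fun w => τ w * σ w) e0 ek eneg ecomp
  refine ⟨_, h1, h2, fun w => ?_⟩
  rw [h3, Finset.image_image, Equiv.Perm.coe_mul]

open Classical in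
/-- Exchange of `α` and `-α` along the chain of `x` and along its image under the involution. -/
lemma exists_swap_neg (h : IsEquivariantColoring ι k f) (hι : Function.Involutive ι)
    (hα : α ∈ palette k) (x : W) :
    ∃ f', IsEquivariantColoring ι k f' ∧ (∀ v w, f' v w = 0 ↔ f v w = 0) ∧
      ∀ w, missingColors k f' w =
        (missingColors k f w).image
          ⇑(if (kempeGraph f α (-α)).Reachable x w ∨ (kempeGraph f α (-α)).Reachable x (ι w)
            then Equiv.swap α (-α) else 1 : Equiv.Perm ℤ) := by
  rw [mem_palette] at hα
  obtain ⟨hα0, hαk⟩ := hα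
  have hα0' : -α ≠ 0 := neg_ne_zero.2 hα0
  let R : W → Prop := (kempeGraph f α (-α)).Reachable x
  have hR : ∀ v w, f v w = α ∨ f v w = -α → (R v ↔ R w) := fun v w hvw =>
    have hadj := ((h.kempeGraph_adj hα0 hα0').2 hvw).reachable
    ⟨fun hh => hh.trans hadj, fun hh => hh.trans hadj.symm⟩
  let σ : W → Equiv.Perm ℤ := fun w => if R w ∨ R (ι w) then Equiv.swap α (-α) else 1
  have e0 : ∀ w, σ w 0 = 0 := by
    intro w
    simp only [σ]
    split_ifs
    · exact Equiv.swap_apply_of_ne_of_ne hα0.symm hα0'.symm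
    · rfl
  have ek : ∀ w c, |σ w c| ≤ k ↔ |c| ≤ k := by
    intro w c
    simp only [σ]
    split_ifs
    · rw [Equiv.swap_apply_def]
      split_ifs with h1 h2
      · simp [h1]
      · simp [h2]
      · rfl
    · rfl
  have eneg : ∀ w c, σ (ι w) (-c) = -σ w c := by
    intro w c
    have : (R (ι w) ∨ R w) ↔ (R w ∨ R (ι w)) := or_comm
    simp only [σ, hι w, this]
    split_ifs
    · simp only [Equiv.swap_apply_def]
      split_ifs <;> omega
    · rfl
  have ecomp : ∀ v w, σ v (f v w) = σ w (f v w) := by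
    intro v w
    simp only [σ]
    by_cases hc : f v w = α ∨ f v w = -α
    · have hc' : f (ι v) (ι w) = α ∨ f (ι v) (ι w) = -α := by
        rw [h.neg]
        omega
      simp only [hR v w hc, hR _ _ hc']
    · push Not at hc
      split_ifs <;> simp [Equiv.swap_apply_of_ne_of_ne hc.1 hc.2]
  obtain ⟨h1, h2, h3⟩ := h.recolor σ e0 ek eneg ecomp
  exact ⟨_, h1, h2, h3⟩

variable {T : Type*} [DecidableEq T] {ν : T → W}

/-- The effect of a Kempe exchange on the colors missing at the vertices `ν t`, of which no two
are exchanged by the involution: at `x` the color `β` is replaced by `α`, and besides at most one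
color `p` is replaced by one color `q` at one index `z`, that of the other end of the chain. -/
lemma exists_kempe (h : IsEquivariantColoring ι k f) (hι : Function.Involutive ι)
    (hν : Function.Injective ν) (hνι : ∀ s t, ν s ≠ ι (ν t))
    (hα : α ∈ palette k) (hβ : β ∈ palette k) {x : T}
    (hβx : β ∈ missingColors k f (ν x)) (hαx : α ∉ missingColors k f (ν x)) :
    ∃ f', IsEquivariantColoring ι k f' ∧ (∀ v w, f' v w = 0 ↔ f v w = 0) ∧
      ((fun t => missingColors k f' (ν t)) =
          replaceElem (fun t => missingColors k f (ν t)) x β α ∨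
        ∃ z p q, (fun t => missingColors k f' (ν t)) =
          replaceElem (replaceElem (fun t => missingColors k f (ν t)) x β α) z p q ∧
          (z ≠ x ∧ (p = α ∨ p = β) ∨ (p = -α ∨ p = -β) ∧ p ≠ α ∧ p ≠ β ∧
            (kempeGraph f α β).Reachable (ν x) (ι (ν z)))) := by
  classical
  have hα0 := (mem_palette.1 hα).1
  have hβ0 := (mem_palette.1 hβ).1
  set m : T → Finset ℤ := fun t => missingColors k f (ν t) with hm
  have hβα : β ≠ α := by
    rintro rfl
    exact hαx hβx
  have huniq := fun v w => IsOtherEnd.unique (v := v) (w := w) h hα0 hβ0 hβx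
  have himage : (m x).image (Equiv.swap α β) = insert α ((m x).erase β) := by
    rw [Equiv.swap_comm]
    exact Finset.image_swap_of_mem hβx hαx
  -- A second change occurs at `z` only if exactly one of the two colors is present.
  have hsecond : ∀ (s : Finset ℤ) (a b : ℤ), s.image (Equiv.swap a b) = s ∨
      ∃ p q, (p = a ∨ p = b) ∧ s.image (Equiv.swap a b) = insert q (s.erase p) := by
    intro s a b
    by_cases h1 : a ∈ s <;> by_cases h2 : b ∈ s
    · exact Or.inl (Finset.image_swap_of_iff (by simp [h1, h2]))
    · exact Or.inr ⟨a, b, Or.inl rfl, Finset.image_swap_of_mem h1 h2⟩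
    · refine Or.inr ⟨b, a, Or.inr rfl, ?_⟩
      rw [Equiv.swap_comm]
      exact Finset.image_swap_of_mem h2 h1
    · exact Or.inl (Finset.image_swap_of_iff (by simp [h1, h2]))
  by_cases hneg : β = -α
  · subst hneg
    obtain ⟨f', hf', hsupp, hmiss⟩ := h.exists_swap_neg hι hα (ν x)
    refine ⟨f', hf', hsupp, ?_⟩
    have hx : missingColors k f' (ν x) = insert α ((m x).erase (-α)) := by
      rw [hmiss, if_pos (Or.inl (SimpleGraph.Reachable.refl _)), himage]
    have hother : ∀ t, t ≠ x → ¬ IsOtherEnd k f α (-α) (ν x) (ν t) →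
        ¬ IsOtherEnd k f α (-α) (ν x) (ι (ν t)) → missingColors k f' (ν t) = m t := by
      intro t htx h1 h2
      rw [hmiss]
      split_ifs with hr
      · refine Finset.image_swap_of_iff ?_
        have hno : ¬ (α ∈ m t ∨ -α ∈ m t) := by
          intro hmem
          rcases hr with hr | hr
          · exact h1 ⟨fun hh => htx (hν hh), hr, hmem⟩
          · refine h2 ⟨(hνι _ _).symm, hr, ?_⟩
            rw [h.missingColors_involution hι, h.missingColors_involution hι, neg_neg]
            exact hmem.symm
        tauto
      · simp [hm]
    by_cases hz : ∃ z, z ≠ x ∧ (IsOtherEnd k f α (-α) (ν x) (ν z) ∨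
        IsOtherEnd k f α (-α) (ν x) (ι (ν z)))
    · obtain ⟨z, hzx, hz⟩ := hz
      have hrest : ∀ t, t ≠ x → t ≠ z → missingColors k f' (ν t) = m t := by
        intro t htx htz
        refine hother t htx (fun ht => ?_) fun ht => ?_ <;> rcases hz with hz | hz
        · exact htz (hν (huniq _ _ ht hz))
        · exact hνι _ _ (huniq _ _ ht hz)
        · exact hνι _ _ (huniq _ _ hz ht)
        · exact htz (hν (hι.injective (huniq _ _ ht hz)))
      have hz' : missingColors k f' (ν z) = (m z).image (Equiv.swap α (-α)) := by
        rw [hmiss, if_pos]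
        rcases hz with hz | hz
        · exact Or.inl hz.2.1
        · exact Or.inr hz.2.1
      rcases hsecond (m z) α (-α) with heq | ⟨p, q, hp, heq⟩
      · left
        funext t
        by_cases htx : t = x
        · rw [htx, replaceElem_self, hx]
        · rw [replaceElem_of_ne _ _ _ htx]
          by_cases htz : t = z
          · rw [htz, hz', heq]
          · exact hrest t htx htz
      · right
        refine ⟨z, p, q, ?_, Or.inl ⟨hzx, hp⟩⟩
        funext t
        by_cases htz : t = z
        · rw [htz, replaceElem_self, replaceElem_of_ne _ _ _ hzx, hz', heq]
        · rw [replaceElem_of_ne _ _ _ htz]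
          by_cases htx : t = x
          · rw [htx, replaceElem_self, hx]
          · rw [replaceElem_of_ne _ _ _ htx]
            exact hrest t htx htz
    · push Not at hz
      left
      funext t
      by_cases htx : t = x
      · rw [htx, replaceElem_self, hx]
      · rw [replaceElem_of_ne _ _ _ htx]
        exact hother t htx (hz t htx).1 (hz t htx).2
  · obtain ⟨f', hf', hsupp, hmiss⟩ := h.exists_swap hι hα hβ hneg (ν x)
    refine ⟨f', hf', hsupp, ?_⟩
    have hx : (m x).image ⇑(if (kempeGraph f α β).Reachable (ν x) (ν x) then Equiv.swap α β
          else 1 : Equiv.Perm ℤ)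
        = insert α ((m x).erase β) := by
      rw [if_pos (SimpleGraph.Reachable.refl _), himage]
    have hfirst : ∀ t, t ≠ x → ¬ IsOtherEnd k f α β (ν x) (ν t) →
        (m t).image ⇑(if (kempeGraph f α β).Reachable (ν x) (ν t) then Equiv.swap α β
          else 1 : Equiv.Perm ℤ)
          = m t := by
      intro t htx h1
      split_ifs with hr
      · refine Finset.image_swap_of_iff ?_
        have hno : ¬ (α ∈ m t ∨ β ∈ m t) := fun hmem => h1 ⟨fun hh => htx (hν hh), hr, hmem⟩
        tauto
      · simp
    have hm1 : ∀ t, ¬ IsOtherEnd k f α β (ν x) (ν t) →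
        (m t).image ⇑(if (kempeGraph f α β).Reachable (ν x) (ν t) then Equiv.swap α β
          else 1 : Equiv.Perm ℤ)
          = replaceElem m x β α t := by
      intro t ht
      by_cases htx : t = x
      · rw [htx, hx, replaceElem_self]
      · rw [hfirst t htx ht, replaceElem_of_ne _ _ _ htx]
    have hsnd : ∀ t, ¬ IsOtherEnd k f α β (ν x) (ι (ν t)) → ∀ s : Finset ℤ,
        (-α ∈ s ↔ -α ∈ m t) → (-β ∈ s ↔ -β ∈ m t) →
        s.image ⇑(if (kempeGraph f α β).Reachable (ν x) (ι (ν t)) then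
          Equiv.swap (-α) (-β) else 1 : Equiv.Perm ℤ) = s := by
      intro t h2 s hs1 hs2
      split_ifs with hr
      · refine Finset.image_swap_of_iff ?_
        have hno : ¬ (-α ∈ m t ∨ -β ∈ m t) := by
          intro hmem
          refine h2 ⟨(hνι _ _).symm, hr, ?_⟩
          rwa [h.missingColors_involution hι, h.missingColors_involution hι]
        tauto
      · simp
    have hkeep : ∀ t, (-α ∈ replaceElem m x β α t ↔ -α ∈ m t) ∧
        (-β ∈ replaceElem m x β α t ↔ -β ∈ m t) := by
      intro t
      constructor
      · exact ⟨mem_of_mem_replaceElem (by omega) t, mem_replaceElem_of_ne (by omega) t⟩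
      · exact ⟨mem_of_mem_replaceElem (by omega) t, mem_replaceElem_of_ne (by omega) t⟩
    have hnone : ∀ t, ¬ IsOtherEnd k f α β (ν x) (ν t) →
        ¬ IsOtherEnd k f α β (ν x) (ι (ν t)) →
        missingColors k f' (ν t) = replaceElem m x β α t := by
      intro t h1 h2
      rw [hmiss]
      change ((m t).image _).image _ = _
      rw [hm1 t h1, hsnd t h2 _ (hkeep t).1 (hkeep t).2]
    by_cases hz : ∃ z, IsOtherEnd k f α β (ν x) (ν z)
    · obtain ⟨z, hz⟩ := hz
      have hzx : z ≠ x := fun hh => hz.1 (by rw [hh])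
      have hrest : ∀ t, t ≠ z → missingColors k f' (ν t) = replaceElem m x β α t :=
        fun t htz => hnone t (fun ht => htz (hν (huniq _ _ ht hz)))
          fun ht => hνι _ _ (huniq _ _ hz ht)
      have hz' : missingColors k f' (ν z) = (m z).image (Equiv.swap α β) := by
        rw [hmiss, if_pos hz.2.1]
        refine hsnd z (fun hh => hνι _ _ (huniq _ _ hz hh)) _ ?_ ?_
        · refine ⟨fun hh => ?_, fun hh => Finset.mem_image.2 ⟨_, hh, ?_⟩⟩
          · obtain ⟨c, hc, hcα⟩ := Finset.mem_image.1 hh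
            rw [← Equiv.eq_symm_apply, Equiv.symm_swap,
              Equiv.swap_apply_of_ne_of_ne (by omega) (by omega)] at hcα
            exact hcα ▸ hc
          · exact Equiv.swap_apply_of_ne_of_ne (by omega) (by omega)
        · refine ⟨fun hh => ?_, fun hh => Finset.mem_image.2 ⟨_, hh, ?_⟩⟩
          · obtain ⟨c, hc, hcα⟩ := Finset.mem_image.1 hh
            rw [← Equiv.eq_symm_apply, Equiv.symm_swap,
              Equiv.swap_apply_of_ne_of_ne (by omega) (by omega)] at hcα
            exact hcα ▸ hc
          · exact Equiv.swap_apply_of_ne_of_ne (by omega) (by omega)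
      rcases hsecond (m z) α β with heq | ⟨p, q, hp, heq⟩
      · left
        funext t
        by_cases htz : t = z
        · rw [htz, hz', heq, replaceElem_of_ne _ _ _ hzx]
        · exact hrest t htz
      · right
        refine ⟨z, p, q, ?_, Or.inl ⟨hzx, hp⟩⟩
        funext t
        by_cases htz : t = z
        · rw [htz, replaceElem_self, replaceElem_of_ne _ _ _ hzx, hz', heq]
        · rw [replaceElem_of_ne _ _ _ htz]
          exact hrest t htz
    · push Not at hz
      by_cases hy : ∃ z, IsOtherEnd k f α β (ν x) (ι (ν z))
      · obtain ⟨z, hy⟩ := hy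
        have hrest : ∀ t, t ≠ z → missingColors k f' (ν t) = replaceElem m x β α t :=
          fun t htz => hnone t (hz t) fun ht => htz (hν (hι.injective (huniq _ _ ht hy)))
        have hz' : missingColors k f' (ν z) =
            (replaceElem m x β α z).image (Equiv.swap (-α) (-β)) := by
          rw [hmiss, if_pos hy.2.1]
          exact congrArg _ (hm1 z (hz z))
        rcases hsecond (replaceElem m x β α z) (-α) (-β) with heq | ⟨p, q, hp, heq⟩
        · left
          funext t
          by_cases htz : t = z
          · rw [htz, hz', heq]
          · exact hrest t htz
        · right
          refine ⟨z, p, q, ?_, Or.inr ⟨hp, by omega, by omega, hy.2.1⟩⟩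
          funext t
          by_cases htz : t = z
          · rw [htz, replaceElem_self, hz', heq]
          · rw [replaceElem_of_ne _ _ _ htz]
            exact hrest t htz
      · push Not at hy
        left
        funext t
        exact hnone t (hz t) (hy t)

end IsEquivariantColoring

end KempeSwap

/-! ### Distinct missing colors at the neighbors of a vertex -/

section MissingColors

variable {W : Type*} [Fintype W]

namespace IsEquivariantColoring

variable {ι : W → W} {k : ℕ} {f : W → W → ℤ} {T : Type*} [DecidableEq T] {ν : T → W}

lemma card_missingColors (h : IsEquivariantColoring ι k f) (x : W) :
    (missingColors k f x).card + {y | f x y ≠ 0}.ncard = 2 * k := by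
  classical
  have himg : (palette k).filter (fun c => ¬ ∀ y, f x y ≠ c)
      = (Finset.univ.filter fun y => f x y ≠ 0).image (f x) := by
    ext c
    simp only [Finset.mem_filter, Finset.mem_image, Finset.mem_univ, true_and, not_forall,
      not_not, mem_palette]
    constructor
    · rintro ⟨⟨h0, -⟩, y, rfl⟩
      exact ⟨y, h0, rfl⟩
    · rintro ⟨y, h0, rfl⟩
      exact ⟨⟨h0, h.abs_le x y⟩, y, rfl⟩
  have hset : {y | f x y ≠ 0} = ((Finset.univ.filter fun y => f x y ≠ 0 : Finset W) : Set W) := by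
    ext y
    simp
  have hinj : Set.InjOn (f x) (Finset.univ.filter fun y => f x y ≠ 0 : Finset W) := by
    intro y hy z _ hyz
    exact h.proper x y z hyz (by simpa using hy)
  rw [hset, Set.ncard_coe_finset, ← Finset.card_image_of_injOn hinj, ← himg, missingColors,
    ← card_palette k]
  exact Finset.card_filter_add_card_filter_not _

/-- A Kempe exchange decreases the size of the greatest deficient set of missing colors. -/
lemma exists_smaller_deficient (h : IsEquivariantColoring ι k f) (hι : Function.Involutive ι)
    (hν : Function.Injective ν) (hνι : ∀ s t, ν s ≠ ι (ν t)) {N S B : Finset T}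
    (hcard : N.card ≤ 2 * k) (h2 : ∀ t ∈ N, 2 ≤ (missingColors k f (ν t)).card)
    (hD : HasDeficiencyOne (fun t => missingColors k f (ν t)) N S B) :
    ∃ f', IsEquivariantColoring ι k f' ∧ (∀ v w, f' v w = 0 ↔ f v w = 0) ∧
      ∀ X ⊆ N, X.card ≤ (X.biUnion fun t => missingColors k f' (ν t)).card + 1 ∧
        ((X.biUnion fun t => missingColors k f' (ν t)).card < X.card → X.card < B.card) := by
  by_contra! hcon
  set m : T → Finset ℤ := fun t => missingColors k f (ν t) with hm
  obtain ⟨β, x₁, hx₁, x₂, hx₂, x₃, hx₃, h₁₂, h₁₃, h₂₃, hβ₁, hβ₂, hβ₃⟩ := hD.exists_three h2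
  obtain ⟨α, hα, hαB⟩ : ∃ α ∈ palette k, α ∉ B.biUnion m := by
    apply Finset.exists_mem_notMem_of_card_lt_card
    rw [card_palette]
    exact hD.deficient_right.trans_le ((Finset.card_le_card hD.subset_right).trans hcard)
  have hβ : β ∈ palette k := (mem_missingColors.1 hβ₁).1
  have key : ∀ x ∈ S, ∀ y ∈ S, ∀ y' ∈ S, y ≠ x → y' ≠ x → y ≠ y' → β ∈ m x → β ∈ m y → β ∈ m y' →
      ∃ z p A, HasDeficiencyOne.IsObstruction m N x β α z p A ∧ (p = -α ∨ p = -β) ∧ p ≠ α ∧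
        p ≠ β ∧ (kempeGraph f α β).Reachable (ν x) (ι (ν z)) := by
    intro x hx y hy y' hy' hyx hyx' hyy hβx hβy hβy'
    have hαx : α ∉ m x := fun hh => hαB
      (Finset.mem_biUnion.2 ⟨x, hD.greatest S hD.subset_left hD.deficient_left hx, hh⟩)
    obtain ⟨f', hf', hsupp, hcase⟩ := h.exists_kempe hι hν hνι hα hβ hβx hαx
    obtain ⟨A, hA, hA'⟩ := hcon f' hf' hsupp
    rcases hcase with hm' | ⟨z, p, q, hm', hpq⟩
    · rw [hm'] at hA'
      have := hD.hall_replaceElem hαB hx hy hyx hβx hβy hA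
      exact absurd (hA' (this.trans (Nat.le_succ _))).1 (not_lt.2 this)
    · rw [hm'] at hA'
      obtain ⟨hdef, hBA⟩ := hA' (hD.card_le_replaceElem_replaceElem hαB hx hy hyx hβx hβy hA)
      have hob := hD.exists_isObstruction hαB hx hy hyx hβx hβy hA hdef hBA
      rcases hpq with ⟨hzx, rfl | rfl⟩ | hpq
      · exact absurd rfl (hob.ne_left hzx)
      · exact absurd rfl (HasDeficiencyOne.IsObstruction.ne_right hD hαB hx hy hy' hyx hyx' hyy
          hβx hβy hβy' hob hzx)
      · exact ⟨z, p, A, hob, hpq⟩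
  -- The chains of two different vertices have different other ends.
  have pair : ∀ x ∈ S, ∀ y ∈ S, x ≠ y → β ∈ m x → β ∈ m y → ∀ z z' p A A',
      HasDeficiencyOne.IsObstruction m N x β α z p A → (p = -α ∨ p = -β) → p ≠ α → p ≠ β →
      HasDeficiencyOne.IsObstruction m N y β α z' p A' →
      (kempeGraph f α β).Reachable (ν x) (ι (ν z)) →
      (kempeGraph f α β).Reachable (ν y) (ι (ν z')) → False := by
    intro x hx y hy hxy hβx hβy z z' p A A' hob hp hpα hpβ hob' hr hr'
    refine HasDeficiencyOne.IsObstruction.false hD hαB hx hy hxy hβx hβy ?_ hpα hpβ hob hob'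
    rintro rfl
    have hpz : p ∈ m z := mem_of_mem_replaceElem hpα _ hob.mem
    refine h.false_of_three_missing (mem_palette.1 hα).1 (mem_palette.1 hβ).1
      (fun hh => hxy (hν hh)) (hνι x z) (hνι y z) (hr.trans hr'.symm) hr (Or.inr hβx)
      (Or.inr hβy) ?_
    rw [h.missingColors_involution hι, h.missingColors_involution hι]
    rcases hp with rfl | rfl
    · exact Or.inl hpz
    · exact Or.inr hpz
  obtain ⟨z₁, p₁, A₁, o₁, c₁, a₁, b₁, r₁⟩ := key x₁ hx₁ x₂ hx₂ x₃ hx₃ h₁₂.symm h₁₃.symm h₂₃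
    hβ₁ hβ₂ hβ₃
  obtain ⟨z₂, p₂, A₂, o₂, c₂, a₂, b₂, r₂⟩ := key x₂ hx₂ x₁ hx₁ x₃ hx₃ h₁₂ h₂₃.symm h₁₃
    hβ₂ hβ₁ hβ₃
  obtain ⟨z₃, p₃, A₃, o₃, c₃, a₃, b₃, r₃⟩ := key x₃ hx₃ x₁ hx₁ x₂ hx₂ h₁₃ h₂₃ h₁₂
    hβ₃ hβ₁ hβ₂
  have : p₁ = p₂ ∨ p₁ = p₃ ∨ p₂ = p₃ := by omega
  rcases this with rfl | rfl | rfl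
  · exact pair x₁ hx₁ x₂ hx₂ h₁₂ hβ₁ hβ₂ _ _ _ _ _ o₁ c₁ a₁ b₁ o₂ r₁ r₂
  · exact pair x₁ hx₁ x₃ hx₃ h₁₃ hβ₁ hβ₃ _ _ _ _ _ o₁ c₁ a₁ b₁ o₃ r₁ r₃
  · exact pair x₂ hx₂ x₃ hx₃ h₂₃ hβ₂ hβ₃ _ _ _ _ _ o₂ c₂ a₂ b₂ o₃ r₂ r₃

lemma exists_hall_of_deficient_lt (hι : Function.Involutive ι)
    (hν : Function.Injective ν) (hνι : ∀ s t, ν s ≠ ι (ν t)) {N : Finset T}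
    (hcard : N.card ≤ 2 * k) (n : ℕ) : ∀ f, IsEquivariantColoring ι k f →
    (∀ t ∈ N, 2 ≤ (missingColors k f (ν t)).card) →
    (∀ X ⊆ N, X.card ≤ (X.biUnion fun t => missingColors k f (ν t)).card + 1 ∧
      ((X.biUnion fun t => missingColors k f (ν t)).card < X.card → X.card < n)) →
    ∃ f', IsEquivariantColoring ι k f' ∧ (∀ v w, f' v w = 0 ↔ f v w = 0) ∧
      ∀ X ⊆ N, X.card ≤ (X.biUnion fun t => missingColors k f' (ν t)).card := by
  induction n with
  | zero =>
    intro f h _ hX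
    refine ⟨f, h, fun v w => Iff.rfl, fun X hXN => ?_⟩
    by_contra! hlt
    exact absurd ((hX X hXN).2 hlt) (Nat.not_lt_zero _)
  | succ n ih =>
    intro f h h2 hX
    by_cases hall : ∀ X ⊆ N, X.card ≤ (X.biUnion fun t => missingColors k f (ν t)).card
    · exact ⟨f, h, fun v w => Iff.rfl, hall⟩
    push Not at hall
    obtain ⟨S, B, hD⟩ := exists_hasDeficiencyOne (fun X hXN => (hX X hXN).1) hall
    obtain ⟨f', h', hsupp, hX'⟩ := h.exists_smaller_deficient hι hν hνι hcard h2 hD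
    have hB := (hX B hD.subset_right).2 hD.deficient_right
    have h2' : ∀ t ∈ N, 2 ≤ (missingColors k f' (ν t)).card := by
      intro t ht
      have e1 := h.card_missingColors (ν t)
      have e2 := h'.card_missingColors (ν t)
      have e3 := h2 t ht
      simp only [ne_eq, hsupp] at e1 e2
      omega
    obtain ⟨f'', h'', hsupp', hX''⟩ := ih f' h' h2' fun X hXN =>
      ⟨(hX' X hXN).1, fun hlt => by have := (hX' X hXN).2 hlt; omega⟩
    exact ⟨f'', h'', fun v w => (hsupp' v w).trans (hsupp v w), hX''⟩

/-- If each of at most `2k` vertices misses at least two colors, then after Kempe exchanges one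
can choose distinct missing colors at these vertices. -/
theorem exists_injective_missingColors [Fintype T] (h : IsEquivariantColoring ι k f)
    (hι : Function.Involutive ι) (hν : Function.Injective ν) (hνι : ∀ s t, ν s ≠ ι (ν t))
    (hcard : Fintype.card T ≤ 2 * k) (h2 : ∀ t, 2 ≤ (missingColors k f (ν t)).card) :
    ∃ f', IsEquivariantColoring ι k f' ∧ (∀ v w, f' v w = 0 ↔ f v w = 0) ∧
      ∃ g : T → ℤ, Function.Injective g ∧ ∀ t, g t ∈ missingColors k f' (ν t) := by
  have key : ∀ N : Finset T, ∃ f', IsEquivariantColoring ι k f' ∧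
      (∀ v w, f' v w = 0 ↔ f v w = 0) ∧
      ∀ X ⊆ N, X.card ≤ (X.biUnion fun t => missingColors k f' (ν t)).card := by
    intro N
    induction N using Finset.induction_on with
    | empty =>
      refine ⟨f, h, fun v w => Iff.rfl, fun X hX => ?_⟩
      rw [Finset.subset_empty.1 hX]
      simp
    | insert a N _ ih =>
      obtain ⟨f₁, h₁, hsupp₁, hall₁⟩ := ih
      have h2' : ∀ t ∈ insert a N, 2 ≤ (missingColors k f₁ (ν t)).card := by
        intro t _
        have e1 := h.card_missingColors (ν t)
        have e2 := h₁.card_missingColors (ν t)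
        have e3 := h2 t
        simp only [ne_eq, hsupp₁] at e1 e2
        omega
      have hdef : ∀ X ⊆ insert a N,
          X.card ≤ (X.biUnion fun t => missingColors k f₁ (ν t)).card + 1 := by
        intro X hX
        have e1 := hall₁ (X.erase a) (by rwa [← Finset.subset_insert_iff])
        have e2 := Finset.card_le_card (Finset.biUnion_subset_biUnion_of_subset_left
          (fun t => missingColors k f₁ (ν t)) (Finset.erase_subset a X))
        have e3 := Finset.pred_card_le_card_erase (s := X) (a := a)
        omega
      obtain ⟨f₂, h₂, hsupp₂, hall₂⟩ := exists_hall_of_deficient_lt hι hν hνι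
        ((Finset.card_le_univ _).trans hcard) ((insert a N).card + 1) f₁ h₁ h2'
        fun X hX => ⟨hdef X hX, fun _ => Nat.lt_succ_of_le (Finset.card_le_card hX)⟩
      exact ⟨f₂, h₂, fun v w => (hsupp₂ v w).trans (hsupp₁ v w), hall₂⟩
  obtain ⟨f', h', hsupp, hall⟩ := key Finset.univ
  exact ⟨f', h', hsupp, (Finset.all_card_le_biUnion_card_iff_exists_injective _).1
    fun X => hall X (Finset.subset_univ _)⟩

end IsEquivariantColoring

end MissingColors

/-! ### Colorings of the signed double cover -/

section DoubleCover

variable {V : Type*}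

/-- The covering involution of the signed double cover of a signed graph on `V`. -/
def coverNeg (x : V × ℤˣ) : V × ℤˣ := (x.1, -x.2)

lemma coverNeg_involutive : Function.Involutive (coverNeg (V := V)) := fun x => by
  simp [coverNeg]

/-- `f` is an equivariant coloring of the signed double cover of the graph `G` with the signs `σ`,
in which `(v, s)` and `(w, t)` are adjacent if `v` and `w` are and `t = -σ v w * s`. The value
`f (v, 1) (w, -σ v w)` is the color at `v` of the edge between `v` and `w`. -/
structure IsCoverColoring (G : SimpleGraph V) (σ : V → V → ℤˣ) (k : ℕ)
    (f : V × ℤˣ → V × ℤˣ → ℤ) : Prop where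
  coloring : IsEquivariantColoring coverNeg k f
  support : ∀ x y, f x y ≠ 0 ↔ G.Adj x.1 y.1 ∧ y.2 = -(σ x.1 y.1 * x.2)

/-- The subgraph on the same vertices of the edges with both ends in `A`. -/
def restrictTo (G : SimpleGraph V) (A : Set V) : SimpleGraph V where
  Adj v w := G.Adj v w ∧ v ∈ A ∧ w ∈ A
  symm := ⟨fun _ _ h => ⟨h.1.symm, h.2.2, h.2.1⟩⟩
  loopless := ⟨fun v h => G.loopless.irrefl v h.1⟩

lemma units_eq_neg_mul_iff (a s t : ℤˣ) : t = -(a * s) ↔ s = -(a * t) := by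
  rcases Int.units_eq_one_or a with rfl | rfl <;> rcases Int.units_eq_one_or s with rfl | rfl <;>
    rcases Int.units_eq_one_or t with rfl | rfl <;> decide

variable [Fintype V] {G : SimpleGraph V} {σ : V → V → ℤˣ} {k : ℕ}

/-- A vertex `u` of degree at most `2k`, all of whose neighbors have degree less than `2k`, can be
added to a graph that is colored with `2k` colors. -/
lemma exists_isCoverColoring_insert (hσ : ∀ v w, σ v w = σ w v) {A : Set V} {u : V} (hu : u ∉ A)
    (hdu : (G.neighborSet u).ncard ≤ 2 * k)
    (hd : ∀ v ∈ A, G.Adj u v → (G.neighborSet v).ncard + 1 ≤ 2 * k)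
    {f : V × ℤˣ → V × ℤˣ → ℤ} (hf : IsCoverColoring (restrictTo G A) σ k f) :
    ∃ f', IsCoverColoring (restrictTo G (insert u A)) σ k f' := by
  classical
  let T := {v : V // G.Adj u v ∧ v ∈ A}
  let ν : T → V × ℤˣ := fun t => (t.1, -σ u t.1)
  have hν : Function.Injective ν := fun s t hst => Subtype.ext (congrArg Prod.fst hst)
  have hνι : ∀ s t, ν s ≠ coverNeg (ν t) := by
    intro s t hst
    have h1 : s.1 = t.1 := congrArg Prod.fst hst
    have h2 : -σ u s.1 = - -σ u t.1 := congrArg Prod.snd hst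
    rw [h1, neg_neg] at h2
    rcases Int.units_eq_one_or (σ u t.1) with h | h <;> rw [h] at h2 <;> exact absurd h2 (by decide)
  have hcard : Fintype.card T ≤ 2 * k := by
    refine le_trans ?_ hdu
    rw [← Nat.card_eq_fintype_card, ← Nat.card_coe_set_eq]
    exact Nat.card_le_card_of_injective (fun t : T => (⟨t.1, t.2.1⟩ : G.neighborSet u))
      fun s t hst => Subtype.ext (congrArg (fun z => z.1) hst)
  have h2 : ∀ t, 2 ≤ (missingColors k f (ν t)).card := by
    intro t
    have e1 := hf.coloring.card_missingColors (ν t)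
    have e2 := hd t.1 t.2.2 t.2.1
    have e3 : {y | f (ν t) y ≠ 0}.ncard ≤ (G.neighborSet t.1 \ {u}).ncard := by
      refine Set.ncard_le_ncard_of_injOn Prod.fst (fun y hy => ?_) (fun y hy z hz hyz => ?_)
        (Set.toFinite _)
      · obtain ⟨h1, -⟩ := (hf.support _ _).1 hy
        refine ⟨h1.1, fun hyu => hu ?_⟩
        rw [Set.mem_singleton_iff] at hyu
        exact hyu ▸ h1.2.2
      · refine Prod.ext hyz ?_
        rw [((hf.support _ _).1 hy).2, ((hf.support _ _).1 hz).2, hyz]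
    have e4 := Set.ncard_sdiff_singleton_add_one
      (show u ∈ G.neighborSet t.1 from t.2.1.symm) (Set.toFinite _)
    omega
  obtain ⟨f', hf', hsupp, g, hg, hgm⟩ := hf.coloring.exists_injective_missingColors
    coverNeg_involutive hν hνι hcard h2
  have hs' : ∀ x y, f' x y ≠ 0 ↔ (restrictTo G A).Adj x.1 y.1 ∧ y.2 = -(σ x.1 y.1 * x.2) :=
    fun x y => (not_congr (hsupp x y)).trans (hf.support x y)
  -- The colors of the edges at `u`, extended by zero.
  let g₀ : V → ℤ := fun v => if h : G.Adj u v ∧ v ∈ A then g ⟨v, h⟩ else 0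
  have hg₀ : ∀ v (h : G.Adj u v ∧ v ∈ A), g₀ v = g ⟨v, h⟩ := fun v h => dif_pos h
  have hg₀z : ∀ v, g₀ v ≠ 0 ↔ G.Adj u v ∧ v ∈ A := by
    intro v
    by_cases h : G.Adj u v ∧ v ∈ A
    · rw [hg₀ v h]
      exact iff_of_true (mem_palette.1 (mem_missingColors.1 (hgm ⟨v, h⟩)).1).1 h
    · simp [g₀, h]
  have hg₀u : g₀ u = 0 := by
    by_contra h
    exact hu ((hg₀z u).1 h).2
  have hg₀inj : ∀ v w, g₀ v = g₀ w → g₀ v ≠ 0 → v = w := by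
    intro v w hvw hv
    have hw := (hg₀z w).1 (hvw ▸ hv)
    rw [hg₀z] at hv
    rw [hg₀ v hv, hg₀ w hw] at hvw
    exact congrArg Subtype.val (hg hvw)
  have hg₀k : ∀ v, |g₀ v| ≤ k := by
    intro v
    by_cases h : G.Adj u v ∧ v ∈ A
    · rw [hg₀ v h]
      exact (mem_palette.1 (mem_missingColors.1 (hgm ⟨v, h⟩)).1).2
    · simp [g₀, h]
  let star : V × ℤˣ → V × ℤˣ → ℤ := fun x y =>
    if y.2 = -(σ u y.1 * x.2) then (x.2 : ℤ) * g₀ y.1 else 0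
  have hstar : ∀ x y, star x y ≠ 0 ↔ y.2 = -(σ u y.1 * x.2) ∧ G.Adj u y.1 ∧ y.1 ∈ A := by
    intro x y
    rw [← hg₀z]
    simp only [star]
    split_ifs with h
    · simp [h]
    · simp [h]
  have hstaru : ∀ x y, y.1 = u → star x y = 0 := by
    intro x y hy
    simp [star, hy, hg₀u]
  have hunit : ∀ s : ℤˣ, |(s : ℤ)| = 1 := fun s => by
    rcases Int.units_eq_one_or s with rfl | rfl <;> simp
  -- Colors at `u` are missing in the old coloring.
  have hnew : ∀ x y z, star x y ≠ 0 → star x y ≠ f' y z := by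
    intro x y z hxy heq
    obtain ⟨h1, h2⟩ := (hstar x y).1 hxy
    have hmiss := (mem_missingColors.1 (hgm ⟨y.1, h2⟩)).2
    rw [← hg₀ y.1 h2] at hmiss
    simp only [star, if_pos h1] at heq
    rcases Int.units_eq_one_or x.2 with hx | hx
    · rw [hx, mul_one] at h1
      rw [hx, Units.val_one, one_mul] at heq
      exact hmiss z (by rw [heq, show ν ⟨y.1, h2⟩ = y from Prod.ext rfl h1.symm])
    · rw [hx, mul_neg, mul_one, neg_neg] at h1
      rw [hx, Units.val_neg, Units.val_one, neg_one_mul] at heq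
      refine hmiss (coverNeg z) ?_
      rw [show ν ⟨y.1, h2⟩ = coverNeg y from Prod.ext rfl (by simp [ν, coverNeg, h1]),
        hf'.neg, ← heq, neg_neg]
  let F : V × ℤˣ → V × ℤˣ → ℤ := fun x y =>
    if x.1 = u then star x y else if y.1 = u then star y x else f' x y
  have Fl : ∀ x y, x.1 = u → F x y = star x y := fun x y hx => by simp [F, hx]
  have Fr : ∀ x y, x.1 ≠ u → y.1 = u → F x y = star y x := fun x y hx hy => by simp [F, hx, hy]
  have Fo : ∀ x y, x.1 ≠ u → y.1 ≠ u → F x y = f' x y := fun x y hx hy => by simp [F, hx, hy]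
  have hstarneg : ∀ x y, star (coverNeg x) (coverNeg y) = -star x y := by
    intro x y
    simp only [star, coverNeg, mul_neg, neg_neg]
    have : (-y.2 = σ u y.1 * x.2) ↔ (y.2 = -(σ u y.1 * x.2)) := neg_eq_iff_eq_neg
    simp only [this]
    split_ifs <;> simp
  have hstark : ∀ x y, |star x y| ≤ k := by
    intro x y
    simp only [star]
    split_ifs
    · rw [abs_mul, hunit, one_mul]
      exact hg₀k _
    · simp
  refine ⟨F, ⟨fun x y => ?_, fun x => ?_, fun x y => ?_, fun x y z hyz hne => ?_, fun x y => ?_⟩,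
    fun x y => ?_⟩
  · by_cases hx : x.1 = u <;> by_cases hy : y.1 = u
    · rw [Fl x y hx, Fl y x hy, hstaru x y hy, hstaru y x hx]
    · rw [Fl x y hx, Fr y x hy hx]
    · rw [Fr x y hx hy, Fl y x hy]
    · rw [Fo x y hx hy, Fo y x hy hx, hf'.symm]
  · by_cases hx : x.1 = u
    · rw [Fl x x hx, hstaru x x hx]
    · rw [Fo x x hx hx, hf'.loopless]
  · by_cases hx : x.1 = u
    · rw [Fl (coverNeg x) (coverNeg y) hx, Fl x y hx, hstarneg]
    · by_cases hy : y.1 = u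
      · rw [Fr (coverNeg x) (coverNeg y) hx hy, Fr x y hx hy, hstarneg]
      · rw [Fo (coverNeg x) (coverNeg y) hx hy, Fo x y hx hy, hf'.neg]
  · by_cases hx : x.1 = u
    · rw [Fl x y hx] at hyz hne
      rw [Fl x z hx] at hyz
      have h1 := (hstar x y).1 hne
      have h2 := (hstar x z).1 (hyz ▸ hne)
      simp only [star, if_pos h1.1, if_pos h2.1] at hyz
      have h3 := hg₀inj y.1 z.1 (mul_left_cancel₀ (Units.ne_zero x.2) hyz) ((hg₀z _).2 h1.2)
      refine Prod.ext h3 ?_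
      rw [h1.1, h2.1, h3]
    · by_cases hy : y.1 = u <;> by_cases hz : z.1 = u
      · rw [Fr x y hx hy] at hyz hne
        rw [Fr x z hx hz] at hyz
        have h1 := ((hstar y x).1 hne).1
        have h2 := ((hstar z x).1 (hyz ▸ hne)).1
        rw [units_eq_neg_mul_iff] at h1 h2
        exact Prod.ext (hy.trans hz.symm) (h1.trans h2.symm)
      · rw [Fr x y hx hy] at hyz hne
        rw [Fo x z hx hz] at hyz
        exact absurd hyz (hnew y x z hne)
      · rw [Fo x y hx hy] at hyz hne
        rw [Fr x z hx hz] at hyz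
        exact absurd hyz.symm (hnew z x y (hyz ▸ hne))
      · rw [Fo x y hx hy] at hyz hne
        rw [Fo x z hx hz] at hyz
        exact hf'.proper x y z hyz hne
  · by_cases hx : x.1 = u
    · rw [Fl x y hx]
      exact hstark x y
    · by_cases hy : y.1 = u
      · rw [Fr x y hx hy]
        exact hstark y x
      · rw [Fo x y hx hy]
        exact hf'.abs_le x y
  · simp only [restrictTo, Set.mem_insert_iff]
    by_cases hx : x.1 = u
    · rw [Fl x y hx, hstar, hx]
      constructor
      · rintro ⟨h1, h2, h3⟩
        exact ⟨⟨h2, Or.inl rfl, Or.inr h3⟩, h1⟩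
      · rintro ⟨⟨h1, -, h2⟩, h3⟩
        exact ⟨h3, h1, h2.resolve_left h1.ne'⟩
    · by_cases hy : y.1 = u
      · rw [Fr x y hx hy, hstar, hy, hσ u, units_eq_neg_mul_iff]
        constructor
        · rintro ⟨h1, h2, h3⟩
          exact ⟨⟨h2.symm, Or.inr h3, Or.inl rfl⟩, h1⟩
        · rintro ⟨⟨h1, h2, -⟩, h3⟩
          exact ⟨h3, h1.symm, h2.resolve_left hx⟩
      · rw [Fo x y hx hy, hs']
        simp only [restrictTo, hx, hy, false_or]

/-- A graph of maximum degree at most `2k` in which the vertices of degree `2k` are independent is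
colored with `2k` colors: add these vertices after all others. -/
theorem exists_isCoverColoring (hσ : ∀ v w, σ v w = σ w v) (I : Set V)
    (hI : ∀ v ∈ I, ∀ w ∈ I, ¬ G.Adj v w) (hdI : ∀ v, (G.neighborSet v).ncard ≤ 2 * k)
    (hd : ∀ v ∉ I, (G.neighborSet v).ncard + 1 ≤ 2 * k) :
    ∃ f, IsCoverColoring G σ k f := by
  classical
  have h0 : ∃ f, IsCoverColoring (restrictTo G ∅) σ k f := by
    refine ⟨fun _ _ => 0, ⟨fun _ _ => rfl, fun _ => rfl, fun _ _ => rfl,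
      fun _ _ _ _ h => absurd rfl h, fun _ _ => ?_⟩, fun _ _ => ?_⟩
    · simp
    · simp [restrictTo]
  have h1 : ∀ A : Finset V, (∀ v ∈ A, v ∉ I) → ∃ f, IsCoverColoring (restrictTo G A) σ k f := by
    intro A
    induction A using Finset.induction_on with
    | empty => exact fun _ => by simpa using h0
    | insert u A hu ih =>
      intro hA
      obtain ⟨f, hf⟩ := ih fun v hv => hA v (Finset.mem_insert_of_mem hv)
      rw [Finset.coe_insert]
      exact exists_isCoverColoring_insert hσ (by simpa using hu) (hdI u)
        (fun v hv _ => hd v (hA v (Finset.mem_insert_of_mem hv))) hf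
  have h2 : ∀ J : Finset V, ∃ f, IsCoverColoring (restrictTo G (↑J ∪ Iᶜ)) σ k f := by
    intro J
    induction J using Finset.induction_on with
    | empty =>
      obtain ⟨f, hf⟩ := h1 (Finset.univ.filter fun v => v ∉ I) (by simp)
      refine ⟨f, ?_⟩
      convert hf using 2
      ext v
      simp
    | insert u J _ ih =>
      obtain ⟨f, hf⟩ := ih
      rw [Finset.coe_insert, Set.insert_union]
      by_cases hu : u ∈ (↑J ∪ Iᶜ : Set V)
      · rw [Set.insert_eq_of_mem hu]
        exact ⟨f, hf⟩
      · have huI : u ∈ I := by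
          by_contra h
          exact hu (Or.inr h)
        exact exists_isCoverColoring_insert hσ hu (hdI u)
          (fun v _ huv => hd v fun hv => hI u huI v hv huv) hf
  obtain ⟨f, hf⟩ := h2 Finset.univ
  have : restrictTo G (↑(Finset.univ : Finset V) ∪ Iᶜ) = G := by
    ext v w
    simp [restrictTo]
  exact ⟨f, this ▸ hf⟩

end DoubleCover

/-! ### The chromatic index of a signed graph -/

namespace SignedGraph

variable {V : Type*} (S : SignedGraph V)

open Classical in
/-- The sign of the edge between `v` and `w`, and `1` if there is none. -/
noncomputable def signFun (v w : V) : ℤˣ :=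
  if h : S.graph.Adj v w then S.sign ⟨s(v, w), h⟩ else 1

lemma signFun_of_adj {v w : V} (h : S.graph.Adj v w) : S.signFun v w = S.sign ⟨s(v, w), h⟩ :=
  dif_pos h

lemma signFun_comm (v w : V) : S.signFun v w = S.signFun w v := by
  by_cases h : S.graph.Adj v w
  · rw [S.signFun_of_adj h, S.signFun_of_adj h.symm]
    exact congrArg S.sign (Subtype.ext Sym2.eq_swap)
  · rw [signFun, signFun, dif_neg h, dif_neg fun h' => h h'.symm]

variable {S}

/-- A coloring given by the colors `c v w` at `v` of the edges between `v` and `w`. -/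
lemma exists_isProper {n : ℕ} (c : V → V → ℤ)
    (hmem : ∀ v w, S.graph.Adj v w → c v w ∈ signedColors n)
    (heq : ∀ v w, S.graph.Adj v w → c v w = -(S.signFun v w : ℤ) * c w v)
    (hinj : ∀ v w w', S.graph.Adj v w → S.graph.Adj v w' → c v w = c v w' → w = w') :
    ∃ γ : S.EdgeColoring n, γ.IsProper := by
  have hadj : ∀ (v : V) (e : S.graph.edgeSet) (h : v ∈ (e : Sym2 V)),
      S.graph.Adj v (Sym2.Mem.other h) := by
    intro v e h
    have := e.2
    rwa [← Sym2.other_spec h] at this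
  refine ⟨⟨fun i => c i.1.1 (Sym2.Mem.other i.2), fun i => hmem _ _ (hadj _ _ i.2), ?_⟩, ?_⟩
  · intro e v w hv hw hvw
    have he : (e : Sym2 V) = s(v, w) := (Sym2.mem_and_mem_iff hvw).1 ⟨hv, hw⟩
    have h1 : Sym2.Mem.other hv = w := Sym2.congr_right.1 ((Sym2.other_spec hv).trans he)
    have h2 : Sym2.Mem.other hw = v :=
      Sym2.congr_right.1 ((Sym2.other_spec hw).trans (he.trans Sym2.eq_swap))
    have hA : S.graph.Adj v w := h1 ▸ hadj v e hv
    have hs : S.sign e = S.signFun v w := by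
      rw [S.signFun_of_adj hA]
      exact congrArg S.sign (Subtype.ext he)
    change c v (Sym2.Mem.other hv) = -(S.sign e : ℤ) * c w (Sym2.Mem.other hw)
    rw [h1, h2, hs]
    exact heq v w hA
  · intro v e f he hf hef h
    refine hef (Subtype.ext ?_)
    have := hinj v _ _ (hadj v e he) (hadj v f hf) h
    rw [← Sym2.other_spec he, ← Sym2.other_spec hf, this]

/-- If the graph without the edges of a matching `M` is colored with `2k` colors, then the edges of
the matching can be given the color `0`. -/
lemma exists_isProper_of_isCoverColoring {n : ℕ} {M : SimpleGraph V} {f : V × ℤˣ → V × ℤˣ → ℤ}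
    (hf : IsCoverColoring (S.graph \ M) S.signFun (n / 2) f)
    (hM : ∀ v w w', M.Adj v w → M.Adj v w' → w = w') (hn : Odd n ∨ M = ⊥) :
    ∃ γ : S.EdgeColoring n, γ.IsProper := by
  have hz : ∀ v w, S.graph.Adj v w → f (v, 1) (w, -S.signFun v w) = 0 → M.Adj v w := by
    intro v w hvw h0
    by_contra hMvw
    exact (hf.support (v, 1) (w, -S.signFun v w)).2 ⟨⟨hvw, hMvw⟩, by simp⟩ h0
  refine exists_isProper (fun v w => f (v, 1) (w, -S.signFun v w)) ?_ ?_ ?_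
  · refine fun v w hvw => ⟨hf.coloring.abs_le _ _, fun h0 => hn.resolve_right ?_⟩
    rintro rfl
    exact hz v w hvw h0
  · intro v w _
    rw [S.signFun_comm w v]
    rcases Int.units_eq_one_or (S.signFun v w) with h | h <;> rw [h]
    · have := hf.coloring.neg (w, 1) (v, -1)
      rw [hf.coloring.symm] at this
      simpa [coverNeg] using this
    · simp [hf.coloring.symm (w, 1)]
  · intro v w w' hvw hvw' h
    by_cases h0 : f (v, 1) (w, -S.signFun v w) = 0
    · exact hM v w w' (hz v w hvw h0) (hz v w' hvw' (h ▸ h0))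
    · exact congrArg Prod.fst (hf.coloring.proper _ _ _ h h0)

variable [Fintype V] [DecidableRel S.graph.Adj]

lemma ncard_signedColors_le (n : ℕ) :
    (signedColors n).Finite ∧ (signedColors n).ncard ≤ n := by
  have habs : ∀ c ∈ signedColors n, |c| ≤ ((n / 2 : ℕ) : ℤ) := fun c hc => hc.1
  rcases Nat.even_or_odd n with hn | hn
  · have hsub : signedColors n ⊆ (palette (n / 2) : Set ℤ) := fun c hc =>
      mem_palette.2 ⟨fun h0 => (Nat.not_odd_iff_even.2 hn) (hc.2 h0), hc.1⟩
    refine ⟨(Finset.finite_toSet _).subset hsub, ?_⟩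
    have := Set.ncard_le_ncard hsub (Finset.finite_toSet _)
    rw [Set.ncard_coe_finset, card_palette] at this
    omega
  · have hsub : signedColors n ⊆ (Finset.Icc (-(n / 2 : ℕ) : ℤ) (n / 2 : ℕ) : Set ℤ) :=
      fun c hc => Finset.mem_coe.2 (Finset.mem_Icc.2 (abs_le.1 hc.1))
    refine ⟨(Finset.finite_toSet _).subset hsub, ?_⟩
    have := Set.ncard_le_ncard hsub (Finset.finite_toSet _)
    rw [Set.ncard_coe_finset, Int.card_Icc] at this
    obtain ⟨m, rfl⟩ := hn
    omega

lemma maxDegree_le_of_isProper {n : ℕ} {γ : S.EdgeColoring n} (hγ : γ.IsProper) :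
    S.graph.maxDegree ≤ n := by
  refine S.graph.maxDegree_le_of_forall_degree_le n fun v => ?_
  obtain ⟨hfin, hle⟩ := ncard_signedColors_le n
  refine le_trans ?_ hle
  rw [← SimpleGraph.card_neighborSet_eq_degree, ← Nat.card_eq_fintype_card,
    ← Nat.card_coe_set_eq]
  have := hfin.to_subtype
  refine Nat.card_le_card_of_injective
    (fun w : S.graph.neighborSet v =>
      (⟨γ.color ⟨(v, ⟨s(v, w), w.2⟩), Sym2.mem_mk_left v w⟩, γ.color_mem _⟩ : signedColors n))
    fun w w' h => ?_
  by_contra hne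
  refine hγ v ⟨s(v, w), w.2⟩ ⟨s(v, w'), w'.2⟩ (Sym2.mem_mk_left v w) (Sym2.mem_mk_left v w')
    (fun he => hne (Subtype.ext ?_)) (congrArg Subtype.val h)
  exact Sym2.congr_right.1 (congrArg Subtype.val he)

lemma exists_isProper_maxDegree_add_one :
    ∃ γ : S.EdgeColoring (S.graph.maxDegree + 1), γ.IsProper := by
  have hdeg : ∀ v, (S.graph.neighborSet v).ncard ≤ S.graph.maxDegree := by
    intro v
    rw [← Nat.card_coe_set_eq, Nat.card_eq_fintype_card, SimpleGraph.card_neighborSet_eq_degree]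
    exact S.graph.degree_le_maxDegree v
  rcases Nat.even_or_odd (S.graph.maxDegree + 1) with ⟨k, hk⟩ | hodd
  · obtain ⟨f, hf⟩ := exists_isCoverColoring (G := S.graph \ ⊥) (k := (S.graph.maxDegree + 1) / 2)
      S.signFun_comm ∅ (by simp) (fun v => by have := hdeg v; rw [sdiff_bot]; omega)
      (fun v _ => by have := hdeg v; rw [sdiff_bot]; omega)
    exact exists_isProper_of_isCoverColoring hf (fun v w w' h => absurd h (by simp)) (Or.inr rfl)
  · -- The color `0` is given to a maximal matching; the uncovered vertices are independent.
    obtain ⟨M, -, hM⟩ := (Set.toFinite {M : SimpleGraph V | M ≤ S.graph ∧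
      ∀ v w w', M.Adj v w → M.Adj v w' → w = w'}).exists_le_maximal
        (show (⊥ : SimpleGraph V) ∈ _ from ⟨bot_le, fun v w w' h => absurd h (by simp)⟩)
    obtain ⟨⟨hMG, hMm⟩, hmax⟩ := hM
    let I : Set V := {v | ∀ w, ¬ M.Adj v w}
    have hI : ∀ v ∈ I, ∀ w ∈ I, ¬ (S.graph \ M).Adj v w := by
      rintro v hv w hw ⟨hvw, hMvw⟩
      have hle := hmax (y := M ⊔ SimpleGraph.edge v w) ⟨sup_le hMG ?_, ?_⟩ le_sup_left
      · exact hMvw (hle (Or.inr ((SimpleGraph.edge_adj v w v w).2 ⟨Or.inl ⟨rfl, rfl⟩, hvw.ne⟩)))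
      · intro a b hab
        rcases (SimpleGraph.edge_adj v w a b).1 hab with ⟨⟨rfl, rfl⟩ | ⟨rfl, rfl⟩, -⟩
        · exact hvw
        · exact hvw.symm
      · intro a b b' hb hb'
        rcases hb with hb | hb <;> rcases hb' with hb' | hb'
        · exact hMm a b b' hb hb'
        · rcases (SimpleGraph.edge_adj v w a b').1 hb' with ⟨⟨rfl, rfl⟩ | ⟨rfl, rfl⟩, -⟩
          · exact absurd hb (hv b)
          · exact absurd hb (hw b)
        · rcases (SimpleGraph.edge_adj v w a b).1 hb with ⟨⟨rfl, rfl⟩ | ⟨rfl, rfl⟩, -⟩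
          · exact absurd hb' (hv b')
          · exact absurd hb' (hw b')
        · rcases (SimpleGraph.edge_adj v w a b).1 hb with ⟨⟨rfl, rfl⟩ | ⟨rfl, rfl⟩, -⟩ <;>
            rcases (SimpleGraph.edge_adj _ _ _ b').1 hb' with ⟨⟨h1, h2⟩ | ⟨h1, h2⟩, h3⟩ <;>
            simp_all
    have hle : ∀ v, ((S.graph \ M).neighborSet v).ncard ≤ (S.graph.neighborSet v).ncard :=
      fun v => Set.ncard_le_ncard (fun w hw => hw.1) (Set.toFinite _)
    have hlt : ∀ v ∉ I, ((S.graph \ M).neighborSet v).ncard + 1 ≤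
        (S.graph.neighborSet v).ncard := by
      intro v hv
      obtain ⟨w, hw⟩ : ∃ w, M.Adj v w := by simpa [I] using hv
      exact Set.ncard_lt_ncard ⟨fun w hw => hw.1, fun hsub => (hsub (hMG hw)).2 hw⟩
        (Set.toFinite _)
    obtain ⟨m, hm⟩ := hodd
    obtain ⟨f, hf⟩ := exists_isCoverColoring (k := (S.graph.maxDegree + 1) / 2)
      S.signFun_comm I hI (fun v => by have := hdeg v; have := hle v; omega)
      (fun v hv => by have := hdeg v; have := hlt v hv; omega)
    exact exists_isProper_of_isCoverColoring hf hMm (Or.inl ⟨m, hm⟩)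

end SignedGraph

theorem theorem4 {V : Type*} [Fintype V] (S : SignedGraph V) [DecidableRel S.graph.Adj] :
    (S.graph.maxDegree : ℕ∞) ≤ S.chromaticIndex ∧
      S.chromaticIndex ≤ (S.graph.maxDegree : ℕ∞) + 1 := by
  constructor
  · refine le_iInf₂ fun n hn => ?_
    obtain ⟨γ, hγ⟩ := hn
    exact Nat.cast_le.2 (SignedGraph.maxDegree_le_of_isProper hγ)
  · refine (iInf₂_le (S.graph.maxDegree + 1) S.exists_isProper_maxDegree_add_one).trans ?_
    exact le_of_eq (Nat.cast_succ _)
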